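/- **Setting.** Let $\Bbbk$ be a commutative ring and let $\mathcal C$ be a $\Bbbk$-linear category with a fixed object $\mathbb 1$ such that $\Bbbk\to\operatorname{End}_{\mathcal C}(\mathbb 1)$, $c\mapsto c\cdot\mathrm{id}$, is bijective. Write $\mathrm{Ps}$ for the pseudo-abelian envelope (formal finite direct sums, then formal images of idempotents). For finite sets $I,J$ and families $U_I=(U_i)_{i\in I}$, $V_J=(V_j)_{j\in J}$ of objects of $\mathcal C$ put $U_\varnothing=V_\varnothing=\mathbb 1$. A *recollement* of finite sets $I_1,\dots,I_l$ is a partition of $I_1\sqcup\dots\sqcup I_l$ each class of which meets each $I_a$ in at most one element. A class is written as a tuple whose $a$-th entry is its element in $I_a$, or $\varnothing$ if there is none. Let $R(I_1,\dots,I_l)$ be the set of recollements, $\#r$ the number of classes of $r$, and $\pi_{a,b}\colon R(I_1,I_2,I_3)\to R(I_a,I_b)$ the restriction. Put $$H_r(U_I;V_J)=\bigotimes_{(i,j)\in r}\operatorname{Hom}_{\mathcal C}(U_i,V_j),\qquad H(U_I;V_J)=\bigoplus_{r\in R(I,J)}H_r(U_I;V_J),\qquad H^{>d}(U_I;V_J)=\bigoplus_{\#r>d}H_r(U_I;V_J).$$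 Let $d\in\mathbb N$. *The category $\mathcal S_d(\mathcal C)$* is $\mathrm{Ps}$ of the $\Bbbk$-linear category with objects $\langle U_I\rangle$ for finite families $U_I$, with $\operatorname{Hom}(\langle U_I\rangle,\langle V_J\rangle)=\{\langle\Phi\rangle\mid\Phi\in H(U_I;V_J)\}\simeq H(U_I;V_J)$ and with the bilinear composition $$\langle\Psi\rangle\circ\langle\Phi\rangle=\sum_{u}\Bigl(\prod_{\#\pi_{1,3}(u)\le a<\#u}(d-a)\Bigr)\langle\Psi\circ_u\Phi\rangle,\qquad \Phi\in H_r(U_I;V_J),\ \Psi\in H_s(V_J;W_K),$$ over all $u\in R(I,J,K)$ with $\pi_{1,2}(u)=r$ and $\pi_{2,3}(u)=s$. Here $\Psi\circ_u\Phi\in H_{\pi_{1,3}(u)}(U_I;W_K)$ is obtained by composing $U_i\to V_j\to W_k$ for each $(i,j,k)\in u$ (with $\mathrm{id}_{\mathbb 1}$ for a factor $\mathbb 1\to\mathbb 1$ at $(\varnothing,\varnothing)$), the composites $\mathbb 1\to V_j\to\mathbb 1$ with $i=k=\varnothing$ being regarded as scalars. *The category $\mathcal W_d(\mathcal C)$.*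 Let $\mathcal C^{\boxtimes d}$ have objects $U_1\boxtimes\dots\boxtimes U_d$ and morphisms $\bigotimes_{a}\operatorname{Hom}_{\mathcal C}(U_a,V_a)$. The symmetric group $\mathfrak S_d$ acts on $\mathrm{Ps}(\mathcal C^{\boxtimes d})$ by permuting factors, and $\mathcal W_d(\mathcal C)=\mathrm{Ps}(\mathcal C^{\boxtimes d})^{\mathfrak S_d}$ is the category of objects $X$ with a coherent system of isomorphisms $g\cdot X\simeq X$ $(g\in\mathfrak S_d)$ and of morphisms commuting with these. *The object $[U_I]\in\mathcal W_d(\mathcal C)$* is $\bigoplus U_{i_1}\boxtimes\dots\boxtimes U_{i_d}$, over all sequences $(i_1,\dots,i_d)$ in $I\sqcup\{\varnothing\}$ in which each element of $I$ occurs exactly once, with the isomorphisms given by permutation of factors and summands (so $[U_I]=0$ if $\#I>d$). For $\Phi=(\Phi_r)_r\in H(U_I;V_J)$, the morphism $[\Phi]\colon[U_I]\to[V_J]$ is given by the following matrix: at the cell $U_{i_1}\boxtimes\dots\boxtimes U_{i_d}\to V_{j_1}\boxtimes\dots\boxtimes V_{j_d}$ its entry is $\Phi_r$, with the factors reordered and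 $\mathrm{id}_{\mathbb 1}$ inserted at each $(\varnothing,\varnothing)$, where $r$ is the recollement whose classes are the pairs $(i_a,j_a)\neq(\varnothing,\varnothing)$. **Theorem.** For all finite families $U_I,V_J$ of objects of $\mathcal C$, the $\Bbbk$-linear map $$\operatorname{Hom}_{\mathcal S_d(\mathcal C)}(\langle U_I\rangle,\langle V_J\rangle)\to\operatorname{Hom}_{\mathcal W_d(\mathcal C)}([U_I],[V_J]),\qquad\langle\Phi\rangle\mapsto[\Phi],$$ is surjective, and its kernel is $\langle H^{>d}(U_I;V_J)\rangle$. It is an isomorphism if $d\ge\#I+\#J$. These maps induce a $\Bbbk$-linear functor $\mathcal S_d(\mathcal C)\to\mathcal W_d(\mathcal C)$, that is, there is a $\Bbbk$-linear functor $F$ with isomorphisms $F(\langle U_I\rangle)\simeq[U_I]$ under which $F(\langle\Phi\rangle)$ corresponds to $[\Phi]$ for all $\Phi$. If $d!$ is invertible in $\Bbbk$, then $F$ is essentially surjective. -/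

import Mathlib

open CategoryTheory
open scoped TensorProduct

universe w v u

noncomputable section
namespace Wreath

/-! ### Tensors indexed by pointed sets -/

section Tensor
open PiTensorProduct

/-- `p` is adapted to the finite set `r` (with respect to the base point `o`): after removing all
occurrences of `o`, the family `p` lists every element of `r` exactly once and nothing else. -/
structure Adapted {X B : Type} (o : X) (r : Finset X) (p : B → X) : Prop where
  base_notMem : o ∉ r
  mem : ∀ b, p b ≠ o → p b ∈ r
  unique : ∀ x ∈ r, ∃! b, p b = x

variable {k : Type w} [CommRing k] {X B : Type} {o : X}
  {E : X → Type v} [∀ x, AddCommGroup (E x)] [∀ x, Module k (E x)]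

/-- Transport along an equality of indices. -/
def castE (k : Type w) [CommRing k] {X : Type} (E : X → Type v) [∀ x, AddCommGroup (E x)]
    [∀ x, Module k (E x)] {x y : X} (h : x = y) : E x ≃ₗ[k] E y := by
  subst h; exact LinearEquiv.refl k (E x)

@[simp] lemma castE_rfl {x : X} (h : x = x) (a : E x) : castE k E h a = a := rfl

lemma castE_apply (θ : ∀ x, E x) {x y : X} (h : x = y) : castE k E h (θ x) = θ y := by
  subst h; rfl

open scoped Classical in
/-- Extend a family indexed by `r` by the element `e` at the base point and by zero elsewhere. -/
def hat (k : Type w) [CommRing k] {X : Type} {o : X} {E : X → Type v} [∀ x, AddCommGroup (E x)]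
    [∀ x, Module k (E x)] (e : E o) (r : Finset X) (φ : ∀ x : r, E x) (x : X) : E x :=
  if h : x ∈ r then φ ⟨x, h⟩ else if h' : o = x then castE k E h' e else 0

lemma hat_mem (e : E o) {r : Finset X} (φ : ∀ x : r, E x) {x : X} (h : x ∈ r) :
    hat k e r φ x = φ ⟨x, h⟩ := by simp [hat, h]

lemma hat_base (e : E o) {r : Finset X} (ho : o ∉ r) (φ : ∀ x : r, E x) :
    hat k e r φ o = e := by simp [hat, ho]

lemma hat_update_ne [DecidableEq X] (e : E o) {r : Finset X} (φ : ∀ x : r, E x) (x : r) (a : E x)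
    [DecidableEq r] {y : X} (h : y ≠ x) : hat k e r (Function.update φ x a) y = hat k e r φ y := by
  unfold hat
  split_ifs with h1 <;> try rfl
  rw [Function.update_of_ne]
  intro h2; exact h (congrArg Subtype.val h2)

/-- The linear map `⨂ₓ E x → ⨂_b E (p b)`, over `x ∈ r` and `b ∈ B`, which reorders the tensor
factors along the adapted family `p` and inserts the element `e` at the base point. -/
def ins (k : Type w) [CommRing k] {X B : Type} {o : X} {E : X → Type v} [∀ x, AddCommGroup (E x)]
    [∀ x, Module k (E x)] (e : E o) {r : Finset X} {p : B → X} (hp : Adapted o r p) :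
    (⨂[k] x : r, E x) →ₗ[k] ⨂[k] b, E (p b) :=
  lift
    { toFun := fun φ => tprod k fun b => hat k e r φ (p b)
      map_update_add' := by
        classical
        intro _ φ x a a'
        obtain ⟨b, hb, hb'⟩ := hp.unique x x.2
        have key : ∀ a, (fun b => hat k e r (Function.update φ x a) (p b)) =
            Function.update (fun b => hat k e r φ (p b)) b (castE k E hb.symm a) := by
          intro a
          funext b'
          by_cases h : b' = b
          · subst h
            obtain ⟨x, hx⟩ := x
            dsimp only at hb
            subst hb
            rw [Function.update_self, hat_mem _ _ hx, Function.update_self]; rfl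
          · rw [Function.update_of_ne h, hat_update_ne]
            exact fun h2 => h (hb' _ h2)
        rw [key, key, key, map_add, MultilinearMap.map_update_add]
      map_update_smul' := by
        classical
        intro _ φ x c a
        obtain ⟨b, hb, hb'⟩ := hp.unique x x.2
        have key : ∀ a, (fun b => hat k e r (Function.update φ x a) (p b)) =
            Function.update (fun b => hat k e r φ (p b)) b (castE k E hb.symm a) := by
          intro a
          funext b'
          by_cases h : b' = b
          · subst h
            obtain ⟨x, hx⟩ := x
            dsimp only at hb
            subst hb
            rw [Function.update_self, hat_mem _ _ hx, Function.update_self]; rfl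
          · rw [Function.update_of_ne h, hat_update_ne]
            exact fun h2 => h (hb' _ h2)
        rw [key, key, map_smul, MultilinearMap.map_update_smul] }

lemma ins_tprod (e : E o) {r : Finset X} {p : B → X} (hp : Adapted o r p) (φ : ∀ x : r, E x) :
    ins k e hp (tprod k φ) = tprod k fun b => hat k e r φ (p b) := by
  simp [ins]

/-- The position at which an adapted family takes the value `x`. -/
def Adapted.pos {r : Finset X} {p : B → X} (hp : Adapted o r p) (x : r) : B :=
  (hp.unique x x.2).choose

lemma Adapted.p_pos {r : Finset X} {p : B → X} (hp : Adapted o r p) (x : r) :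
    p (hp.pos x) = x := (hp.unique x x.2).choose_spec.1

lemma Adapted.pos_eq {r : Finset X} {p : B → X} (hp : Adapted o r p) (x : r) {b : B}
    (h : p b = x) : hp.pos x = b := ((hp.unique x x.2).choose_spec.2 b h).symm

open scoped Classical in
/-- The scalar attached to a factor: `sc` at the base point and `1` elsewhere. -/
def scAt (sc : E o →ₗ[k] k) (x : X) (a : E x) : k :=
  if h : x = o then sc (castE k E h a) else 1

/-- The linear map `⨂_b E (p b) → ⨂ₓ E x`, over `b ∈ B` and `x ∈ r`, which turns the factors at the
base point into scalars by means of `sc` and reorders the other ones. -/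
def con (k : Type w) [CommRing k] {X B : Type} [Fintype B] {o : X} {E : X → Type v}
    [∀ x, AddCommGroup (E x)]
    [∀ x, Module k (E x)] (sc : E o →ₗ[k] k) {r : Finset X} {p : B → X} (hp : Adapted o r p) :
    (⨂[k] b, E (p b)) →ₗ[k] ⨂[k] x : r, E x :=
  lift
    { toFun := fun θ => (∏ b, scAt sc (p b) (θ b)) •
        tprod k fun x : r => castE k E (hp.p_pos x) (θ (hp.pos x))
      map_update_add' := by
        classical
        intro _ θ b a a'
        by_cases hb : p b = o
        · have key : ∀ a, (fun x : r => castE k E (hp.p_pos x) (Function.update θ b a (hp.pos x))) =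
              fun x : r => castE k E (hp.p_pos x) (θ (hp.pos x)) := by
            intro a; funext x
            rw [Function.update_of_ne]
            rintro h
            apply hp.base_notMem
            rw [← hb, ← h, hp.p_pos]; exact x.2
          have key2 : ∀ a, (∏ b', scAt sc (p b') (Function.update θ b a b')) =
              sc (castE k E hb a) * ∏ b' ∈ Finset.univ.erase b, scAt sc (p b') (θ b') := by
            intro a
            rw [← Finset.mul_prod_erase _ _ (Finset.mem_univ b)]
            congr 1
            · simp [scAt, hb]
            · refine Finset.prod_congr rfl fun b' hb' => ?_
              rw [Function.update_of_ne (Finset.ne_of_mem_erase hb')]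
          simp only [key, key2, map_add, add_mul, add_smul]
        · have hx : p b ∈ r := hp.mem b hb
          have hpos : hp.pos ⟨p b, hx⟩ = b := hp.pos_eq _ rfl
          have key : ∀ a, (fun x : r => castE k E (hp.p_pos x) (Function.update θ b a (hp.pos x))) =
              Function.update (fun x : r => castE k E (hp.p_pos x) (θ (hp.pos x))) ⟨p b, hx⟩ a := by
            intro a; funext x
            by_cases h : x = ⟨p b, hx⟩
            · subst h
              rw [Function.update_self]
              have : ∀ (b' : B) (hb' : b' = b) (h' : p b' = p b),
                castE k E h' (Function.update θ b a b') = a := by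
                rintro b' rfl h'; simp
              exact this _ hpos _
            · rw [Function.update_of_ne h, Function.update_of_ne]
              intro h2; apply h; apply Subtype.ext; rw [← hp.p_pos x, h2]
          have key2 : ∀ a, (∏ b', scAt sc (p b') (Function.update θ b a b')) =
              ∏ b', scAt sc (p b') (θ b') := by
            intro a
            refine Finset.prod_congr rfl fun b' _ => ?_
            by_cases h : b' = b
            · subst h; simp [scAt, hb]
            · rw [Function.update_of_ne h]
          simp only [key, key2, MultilinearMap.map_update_add, smul_add]
      map_update_smul' := by
        classical
        intro _ θ b c a
        by_cases hb : p b = o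
        · have key : ∀ a, (fun x : r => castE k E (hp.p_pos x) (Function.update θ b a (hp.pos x))) =
              fun x : r => castE k E (hp.p_pos x) (θ (hp.pos x)) := by
            intro a; funext x
            rw [Function.update_of_ne]
            rintro h
            apply hp.base_notMem
            rw [← hb, ← h, hp.p_pos]; exact x.2
          have key2 : ∀ a, (∏ b', scAt sc (p b') (Function.update θ b a b')) =
              sc (castE k E hb a) * ∏ b' ∈ Finset.univ.erase b, scAt sc (p b') (θ b') := by
            intro a
            rw [← Finset.mul_prod_erase _ _ (Finset.mem_univ b)]
            congr 1
            · simp [scAt, hb]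
            · refine Finset.prod_congr rfl fun b' hb' => ?_
              rw [Function.update_of_ne (Finset.ne_of_mem_erase hb')]
          simp only [key, key2, map_smul, smul_eq_mul, mul_assoc, mul_smul]
        · have hx : p b ∈ r := hp.mem b hb
          have hpos : hp.pos ⟨p b, hx⟩ = b := hp.pos_eq _ rfl
          have key : ∀ a, (fun x : r => castE k E (hp.p_pos x) (Function.update θ b a (hp.pos x))) =
              Function.update (fun x : r => castE k E (hp.p_pos x) (θ (hp.pos x))) ⟨p b, hx⟩ a := by
            intro a; funext x
            by_cases h : x = ⟨p b, hx⟩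
            · subst h
              rw [Function.update_self]
              have : ∀ (b' : B) (hb' : b' = b) (h' : p b' = p b),
                castE k E h' (Function.update θ b a b') = a := by
                rintro b' rfl h'; simp
              exact this _ hpos _
            · rw [Function.update_of_ne h, Function.update_of_ne]
              intro h2; apply h; apply Subtype.ext; rw [← hp.p_pos x, h2]
          have key2 : ∀ a, (∏ b', scAt sc (p b') (Function.update θ b a b')) =
              ∏ b', scAt sc (p b') (θ b') := by
            intro a
            refine Finset.prod_congr rfl fun b' _ => ?_
            by_cases h : b' = b
            · subst h; simp [scAt, hb]
            · rw [Function.update_of_ne h]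
          simp only [key, key2, MultilinearMap.map_update_smul]
          rw [smul_comm] }

lemma con_tprod [Fintype B] (sc : E o →ₗ[k] k) {r : Finset X} {p : B → X} (hp : Adapted o r p)
    (θ : ∀ b, E (p b)) :
    con k sc hp (tprod k θ) = (∏ b, scAt sc (p b) (θ b)) •
        tprod k fun x : r => castE k E (hp.p_pos x) (θ (hp.pos x)) := by
  simp [con]

lemma castE_comp {Y : Type} {π : Y → X} (θ : ∀ y, E (π y)) {y y' : Y} (h : y = y') {x : X}
    (h1 : π y = x) (h2 : π y' = x) : castE k E h1 (θ y) = castE k E h2 (θ y') := by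
  subst h; rfl

lemma con_ins [Fintype B] (e : E o) (sc : E o →ₗ[k] k) (he : sc e = 1) {r : Finset X} {p : B → X}
    (hp : Adapted o r p) (Φ : ⨂[k] x : r, E x) : con k sc hp (ins k e hp Φ) = Φ := by
  suffices h : (con k sc hp).comp (ins k e hp) = LinearMap.id from LinearMap.congr_fun h Φ
  refine PiTensorProduct.ext (MultilinearMap.ext fun φ => ?_)
  simp only [LinearMap.compMultilinearMap_apply, LinearMap.comp_apply, LinearMap.id_apply,
    ins_tprod, con_tprod]
  have h1 : ∏ b, scAt sc (p b) (hat k e r φ (p b)) = 1 := by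
    refine Finset.prod_eq_one fun b _ => ?_
    unfold scAt
    split_ifs with h
    · rw [castE_apply, hat_base _ hp.base_notMem, he]
    · rfl
  rw [h1, one_smul]
  congr 1
  funext x
  rw [castE_apply, hat_mem _ _ x.2]

/-- Compatibility of insertion and contraction with a relabelling. -/
lemma ins_con_relabel [Fintype B] (e : E o) (sc : E o →ₗ[k] k) (he : sc e = 1)
    (hsc : ∀ a, sc a • e = a)
    {Y : Type} {oY : Y} {u : Finset Y} {π : Y → X} (hπ : π oY = o) {r : Finset X}
    (hu : Adapted o r (fun y : u => π y)) {q : B → Y} (hq : Adapted oY u q)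
    (hpq : Adapted o r (fun b => π (q b)))
    (θ : ∀ y, E (π y)) (hθ : castE k E hπ (θ oY) = e) :
    ins k e hpq (con k sc hu (tprod k fun y : u => θ y)) = tprod k fun b => θ (q b) := by
  classical
  rw [con_tprod, map_smul, ins_tprod]
  have h1 : (fun b => θ (q b)) = fun b => scAt sc (π (q b)) (θ (q b)) •
      hat k e r (fun x : r => castE k E (hu.p_pos x) (θ (hu.pos x))) (π (q b)) := by
    funext b
    by_cases hb : π (q b) = o
    · simp only [scAt, hb, dif_pos]
      have : ∀ (x : X) (hx : x = o) (a : E x) (φ : ∀ x : r, E x),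
          a = sc (castE k E hx a) • hat k e r φ x := by
        rintro x rfl a φ
        rw [hat_base _ hu.base_notMem, castE_rfl, hsc]
      exact this _ hb _ _
    · have hmem : π (q b) ∈ r := hpq.mem b hb
      have hqu : q b ∈ u := hq.mem b (fun h => hb (by rw [h, hπ]))
      rw [hat_mem _ _ hmem]
      simp only [scAt, hb, dif_neg, not_false_eq_true, one_smul]
      have hpos : hu.pos ⟨π (q b), hmem⟩ = ⟨q b, hqu⟩ := hu.pos_eq _ rfl
      have := castE_comp (k := k) (π := π) θ (congrArg Subtype.val hpos)
        (hu.p_pos ⟨π (q b), hmem⟩) rfl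
      exact this.symm
  rw [h1, MultilinearMap.map_smul_univ]
  congr 1
  set F : Y → k := fun y => scAt sc (π y) (θ y) with hF
  have hFo : F oY = 1 := by
    simp only [hF, scAt, hπ, dif_pos]; rw [hθ, he]
  change ∏ y : u, F y = ∏ b, F (q b)
  rw [Finset.prod_coe_sort u F]
  rw [← Finset.prod_filter_of_ne (s := Finset.univ) (p := fun b => q b ≠ oY)
    (fun b _ h h' => h (by rw [h', hFo]))]
  symm
  refine Finset.prod_bij (fun b _ => q b) ?_ ?_ ?_ ?_
  · intro b hb; exact hq.mem b (Finset.mem_filter.1 hb).2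
  · intro b hb b' hb' h
    obtain ⟨c, _, hc⟩ := hq.unique (q b) (hq.mem b (Finset.mem_filter.1 hb).2)
    rw [hc b rfl, hc b' h.symm]
  · intro y hy
    obtain ⟨b, hb, _⟩ := hq.unique y hy
    refine ⟨b, Finset.mem_filter.2 ⟨Finset.mem_univ _, ?_⟩, hb⟩
    rw [hb]; rintro rfl; exact hq.base_notMem hy
  · intros; rfl

end Tensor


/-! ### Linear categories: envelopes and tensor powers -/

section Envelopes

variable (k : Type w) [CommRing k] (D : Type u) [Category.{v} D] [Preadditive D] [Linear k D]

instance matModule (M N : Mat_ D) : Module k (M ⟶ N) where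
  smul c f := fun i j => c • f i j
  one_smul f := by funext i j; exact one_smul k (f i j)
  mul_smul c c' f := by funext i j; exact mul_smul c c' (f i j)
  smul_zero c := by funext i j; exact smul_zero c
  smul_add c f g := by funext i j; exact smul_add c (f i j) (g i j)
  add_smul c c' f := by funext i j; exact add_smul c c' (f i j)
  zero_smul f := by funext i j; exact zero_smul k (f i j)

@[simp] lemma mat_smul_apply {M N : Mat_ D} (c : k) (f : M ⟶ N) (i : M.ι) (j : N.ι) :
    (c • f) i j = c • f i j := rfl

instance matLinear : Linear k (Mat_ D) where
  smul_comp M N K c f g := by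
    apply Mat_.hom_ext; intro i j
    simp [Finset.smul_sum]
  comp_smul M N K f c g := by
    apply Mat_.hom_ext; intro i j
    simp [Finset.smul_sum]

open Idempotents in
instance karModule (P Q : Karoubi D) : Module k (P ⟶ Q) where
  smul c f := ⟨c • f.f, by rw [Linear.smul_comp, Linear.comp_smul, f.comm]⟩
  one_smul f := by ext; exact one_smul k f.f
  mul_smul c c' f := by ext; exact mul_smul c c' f.f
  smul_zero c := by ext; exact smul_zero c
  smul_add c f g := by ext; exact smul_add c f.f g.f
  add_smul c c' f := by ext; exact add_smul c c' f.f
  zero_smul f := by ext; exact zero_smul k f.f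

open Idempotents in
@[simp] lemma kar_smul_f {P Q : Karoubi D} (c : k) (f : P ⟶ Q) : (c • f).f = c • f.f := rfl

open Idempotents in
instance karLinear : Linear k (Karoubi D) where
  smul_comp P Q R c f g := by ext; simp
  comp_smul P Q R f c g := by ext; simp

/-- The pseudo-abelian envelope: the Karoubian envelope of the additive envelope. -/
abbrev Ps (D : Type u) [Category.{v} D] [Preadditive D] := Idempotents.Karoubi (Mat_ D)

/-- The embedding of a category into its pseudo-abelian envelope. -/
abbrev toPs (D : Type u) [Category.{v} D] [Preadditive D] : D ⥤ Ps D :=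
  Mat_.embedding D ⋙ Idempotents.toKaroubi (Mat_ D)

variable {D}

/-- The functor between pseudo-abelian envelopes induced by an additive functor. -/
abbrev psMap {D' : Type u} [Category.{v} D'] [Preadditive D'] (F : D ⥤ D') [F.Additive] :
    Ps D ⥤ Ps D' :=
  (Idempotents.functorExtension₂ (Mat_ D) (Mat_ D')).obj F.mapMat_

instance psMap_additive {D' : Type u} [Category.{v} D'] [Preadditive D'] (F : D ⥤ D')
    [F.Additive] : (psMap F).Additive where
  map_add {P Q f g} := by
    ext i j
    exact F.map_add

instance psMap_linear {D' : Type u} [Category.{v} D'] [Preadditive D'] [Linear k D'] (F : D ⥤ D')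
    [F.Additive] [F.Linear k] : (psMap F).Linear k where
  map_smul {P Q} f r := by
    ext i j
    exact F.map_smul r _

end Envelopes

section TensorPower
open PiTensorProduct

variable (k : Type w) [CommRing k] {C : Type u} [Category.{v} C] [Preadditive C] [Linear k C]

/-- Factorwise composition of tensors of morphisms. -/
def compT {B : Type} (U V W : B → C) :
    (⨂[k] b, (U b ⟶ V b)) →ₗ[k] (⨂[k] b, (V b ⟶ W b)) →ₗ[k] ⨂[k] b, (U b ⟶ W b) :=
  map₂ fun b => Linear.comp (U b) (V b) (W b)

variable {k}

lemma compT_tprod {B : Type} (U V W : B → C) (f : ∀ b, U b ⟶ V b) (g : ∀ b, V b ⟶ W b) :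
    compT k U V W (tprod k f) (tprod k g) = tprod k fun b => f b ≫ g b := by
  simp [compT, map₂_tprod_tprod]

lemma compT_id_left {B : Type} (U V : B → C) (f : ⨂[k] b, (U b ⟶ V b)) :
    compT k U U V (tprod k fun b => 𝟙 (U b)) f = f := by
  suffices h : compT k U U V (tprod k fun b => 𝟙 (U b)) = LinearMap.id from LinearMap.congr_fun h f
  refine PiTensorProduct.ext (MultilinearMap.ext fun φ => ?_)
  simp [compT_tprod]

lemma compT_id_right {B : Type} (U V : B → C) (f : ⨂[k] b, (U b ⟶ V b)) :
    compT k U V V f (tprod k fun b => 𝟙 (V b)) = f := by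
  suffices h : (compT k U V V).flip (tprod k fun b => 𝟙 (V b)) = LinearMap.id from
    LinearMap.congr_fun h f
  refine PiTensorProduct.ext (MultilinearMap.ext fun φ => ?_)
  simp [compT_tprod]

lemma compT_assoc {B : Type} (U V W X : B → C) (f : ⨂[k] b, (U b ⟶ V b))
    (g : ⨂[k] b, (V b ⟶ W b)) (h : ⨂[k] b, (W b ⟶ X b)) :
    compT k U W X (compT k U V W f g) h = compT k U V X f (compT k V W X g h) := by
  induction f using PiTensorProduct.induction_on with
  | add f f' hf hf' => simp only [map_add, LinearMap.add_apply, hf, hf']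
  | smul_tprod c f =>
  induction g using PiTensorProduct.induction_on with
  | add g g' hg hg' => simp only [map_add, LinearMap.add_apply, hg, hg']
  | smul_tprod c' g =>
  induction h using PiTensorProduct.induction_on with
  | add h h' hh hh' => simp only [map_add, hh, hh']
  | smul_tprod c'' h => simp [compT_tprod]

lemma compT_reindex {B B' : Type} (σ : B ≃ B') (U V W : B → C) (f : ⨂[k] b, (U b ⟶ V b))
    (g : ⨂[k] b, (V b ⟶ W b)) :
    reindex k (fun b => (U b ⟶ W b)) σ (compT k U V W f g) =
      compT k (fun b => U (σ.symm b)) (fun b => V (σ.symm b)) (fun b => W (σ.symm b))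
        (reindex k (fun b => (U b ⟶ V b)) σ f) (reindex k (fun b => (V b ⟶ W b)) σ g) := by
  induction f using PiTensorProduct.induction_on with
  | add f f' hf hf' => simp only [map_add, LinearMap.add_apply, hf, hf']
  | smul_tprod c f =>
  induction g using PiTensorProduct.induction_on with
  | add g g' hg hg' => simp only [map_add, hg, hg']
  | smul_tprod c' g =>
    simp only [map_smul, LinearMap.smul_apply, compT_tprod, reindex_tprod]

variable (k C)

/-- The objects `U₁ ⊠ ⋯ ⊠ U_d` of the `d`-fold tensor power of the `k`-linear category `C`. -/
structure TP (k : Type w) (C : Type u) (d : ℕ) where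
  obj : Fin d → C

variable {C} {d : ℕ}

instance : Category (TP k C d) where
  Hom U V := ⨂[k] a, (U.obj a ⟶ V.obj a)
  id U := tprod k fun a => 𝟙 (U.obj a)
  comp {U V W} f g := compT k U.obj V.obj W.obj f g
  id_comp {U V} f := compT_id_left U.obj V.obj f
  comp_id {U V} f := compT_id_right U.obj V.obj f
  assoc {U V W X} f g h := compT_assoc U.obj V.obj W.obj X.obj f g h

instance TP.homGroup (U V : TP k C d) : AddCommGroup (U ⟶ V) :=
  inferInstanceAs (AddCommGroup (⨂[k] a, (U.obj a ⟶ V.obj a)))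

instance TP.homModule (U V : TP k C d) : Module k (U ⟶ V) :=
  inferInstanceAs (Module k (⨂[k] a, (U.obj a ⟶ V.obj a)))

lemma TP.add_comp' (U V W : TP k C d) (f f' : U ⟶ V) (g : V ⟶ W) :
    (f + f') ≫ g = f ≫ g + f' ≫ g := by
  have h := LinearMap.congr_fun (map_add (compT k U.obj V.obj W.obj) f f') g
  rw [LinearMap.add_apply] at h
  exact h

lemma TP.comp_add' (U V W : TP k C d) (f : U ⟶ V) (g g' : V ⟶ W) :
    f ≫ (g + g') = f ≫ g + f ≫ g' := by
  have h := map_add (compT k U.obj V.obj W.obj f) g g'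
  exact h

lemma TP.smul_comp' (U V W : TP k C d) (c : k) (f : U ⟶ V) (g : V ⟶ W) :
    (c • f) ≫ g = c • (f ≫ g) := by
  have h := LinearMap.congr_fun (map_smul (compT k U.obj V.obj W.obj) c f) g
  rw [LinearMap.smul_apply] at h
  exact h

lemma TP.comp_smul' (U V W : TP k C d) (f : U ⟶ V) (c : k) (g : V ⟶ W) :
    f ≫ (c • g) = c • (f ≫ g) := by
  have h := map_smul (compT k U.obj V.obj W.obj f) c g
  exact h

instance : Preadditive (TP k C d) where
  homGroup U V := TP.homGroup k U V
  add_comp U V W f f' g := TP.add_comp' k U V W f f' g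
  comp_add U V W f g g' := TP.comp_add' k U V W f g g'

instance : Linear k (TP k C d) where
  homModule U V := TP.homModule k U V
  smul_comp U V W c f g := TP.smul_comp' k U V W c f g
  comp_smul U V W f c g := TP.comp_smul' k U V W f c g

variable (C)

/-- The permutation `g` acts on the tensor power by permuting the factors:
`(g · U)_a = U_{g⁻¹ a}`. -/
def permTP (g : Equiv.Perm (Fin d)) : TP k C d ⥤ TP k C d where
  obj U := ⟨fun a => U.obj (g.symm a)⟩
  map {U V} f := reindex k (fun a => (U.obj a ⟶ V.obj a)) g f
  map_id _ := reindex_tprod g _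
  map_comp {U V W} f g' := compT_reindex g U.obj V.obj W.obj f g'

instance (g : Equiv.Perm (Fin d)) : (permTP k C g).Additive where
  map_add {U V f f'} := map_add (reindex k (fun a => (U.obj a ⟶ V.obj a)) g) f f'

instance (g : Equiv.Perm (Fin d)) : (permTP k C g).Linear k where
  map_smul {U V} f c := map_smul (reindex k (fun a => (U.obj a ⟶ V.obj a)) g) c f

end TensorPower

/-! ### Group actions on categories and invariants -/

section Action

/-- An action of a group on a `k`-linear category. -/
structure CatAction (k : Type w) [CommRing k] (G : Type) [Group G] (D : Type u) [Category.{v} D]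
    [Preadditive D] [Linear k D] where
  /-- the endofunctor `U ↦ g · U` -/
  act : G → D ⥤ D
  additive : ∀ g, (act g).Additive
  linear : ∀ g, (act g).Linear k
  /-- the isomorphisms `g · (h · U) ≅ gh · U` -/
  mul : ∀ g h : G, act h ⋙ act g ≅ act (g * h)
  /-- the isomorphisms `U ≅ 1 · U` -/
  one : 𝟭 D ≅ act 1
  assoc : ∀ (g h l : G) (U : D),
    (act g).map ((mul h l).hom.app U) ≫ (mul g (h * l)).hom.app U =
      (mul g h).hom.app ((act l).obj U) ≫ (mul (g * h) l).hom.app U ≫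
        eqToHom (by rw [mul_assoc])
  mul_one : ∀ (g : G) (U : D),
    (act g).map (one.hom.app U) ≫ (mul g 1).hom.app U = eqToHom (by rw [mul_one]; rfl)
  one_mul : ∀ (g : G) (U : D),
    one.hom.app ((act g).obj U) ≫ (mul 1 g).hom.app U = eqToHom (by rw [one_mul]; rfl)

variable {k : Type w} [CommRing k] {G : Type} [Group G] {D : Type u} [Category.{v} D]
    [Preadditive D] [Linear k D]

/-- An invariant object: an object `U` with isomorphisms `κ g : g · U ≅ U` compatible with the
group structure. -/
structure Inv (A : CatAction k G D) where
  obj : D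
  κ : ∀ g : G, (A.act g).obj obj ≅ obj
  mul : ∀ g h : G, (A.act g).map (κ h).hom ≫ (κ g).hom = (A.mul g h).hom.app obj ≫ (κ (g * h)).hom
  one : A.one.hom.app obj ≫ (κ 1).hom = 𝟙 obj

variable {A : CatAction k G D}

/-- An invariant morphism: a morphism which commutes with the isomorphisms `κ`. -/
@[ext] structure Inv.Hom (U V : Inv A) where
  hom : U.obj ⟶ V.obj
  comm : ∀ g : G, (A.act g).map hom ≫ (V.κ g).hom = (U.κ g).hom ≫ hom

instance : Category (Inv A) where
  Hom := Inv.Hom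
  id U := ⟨𝟙 _, by simp⟩
  comp f f' := ⟨f.hom ≫ f'.hom, fun g => by
    rw [Functor.map_comp, Category.assoc, f'.comm, ← Category.assoc, f.comm, Category.assoc]⟩
  id_comp f := Inv.Hom.ext (Category.id_comp _)
  comp_id f := Inv.Hom.ext (Category.comp_id _)
  assoc f g h := Inv.Hom.ext (Category.assoc _ _ _)

@[ext] lemma Inv.hom_ext {U V : Inv A} {f g : U ⟶ V} (h : f.hom = g.hom) : f = g := Inv.Hom.ext h

@[simp] lemma Inv.comp_hom {U V W : Inv A} (f : U ⟶ V) (g : V ⟶ W) :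
    (f ≫ g).hom = f.hom ≫ g.hom := rfl

/-- The invariant morphisms as a submodule of all morphisms. -/
def Inv.homSub (U V : Inv A) : Submodule k (U.obj ⟶ V.obj) where
  carrier := {f | ∀ g : G, (A.act g).map f ≫ (V.κ g).hom = (U.κ g).hom ≫ f}
  add_mem' {a b} ha hb g := by
    have := A.additive g
    simp [ha g, hb g]
  zero_mem' g := by
    have := A.additive g
    simp
  smul_mem' c a ha g := by
    have := A.linear g
    simp [ha g]

/-- The bijection which puts the module structure on the invariant morphisms. -/
def Inv.homEquiv (U V : Inv A) : (U ⟶ V) ≃ Inv.homSub U V where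
  toFun f := ⟨f.hom, f.comm⟩
  invFun f := ⟨f.1, f.2⟩
  left_inv _ := rfl
  right_inv _ := rfl

instance (U V : Inv A) : AddCommGroup (U ⟶ V) := (Inv.homEquiv U V).addCommGroup

instance (U V : Inv A) : Module k (U ⟶ V) := (Inv.homEquiv U V).module k

@[simp] lemma Inv.add_hom {U V : Inv A} (f g : U ⟶ V) : (f + g).hom = f.hom + g.hom := rfl

@[simp] lemma Inv.smul_hom {U V : Inv A} (c : k) (f : U ⟶ V) : (c • f).hom = c • f.hom := rfl

instance : Preadditive (Inv A) where
  add_comp U V W f f' g := by ext; simp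
  comp_add U V W f g g' := by ext; simp

instance : Linear k (Inv A) where
  smul_comp U V W c f g := by ext; simp
  comp_smul U V W f c g := by ext; simp

end Action

/-! ### Recollements -/

section Recollement

/-- A recollement of `I` and `J`, written as the set of its classes: a class `{i, j}` is the pair
`(some i, some j)`, a class `{i}` is `(some i, none)` and a class `{j}` is `(none, some j)`. -/
@[ext] structure Recol (I J : Type) where
  blocks : Finset (Option I × Option J)
  none_notMem : (none, none) ∉ blocks
  fst : ∀ i : I, ∃! x : blocks, x.1.1 = some i
  snd : ∀ j : J, ∃! x : blocks, x.1.2 = some j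

/-- A recollement of `I`, `J` and `K`, written as the set of its classes. -/
@[ext] structure Recol₃ (I J K : Type) where
  blocks : Finset (Option I × Option J × Option K)
  none_notMem : (none, none, none) ∉ blocks
  fst : ∀ i : I, ∃! x : blocks, x.1.1 = some i
  snd : ∀ j : J, ∃! x : blocks, x.1.2.1 = some j
  trd : ∀ l : K, ∃! x : blocks, x.1.2.2 = some l

variable {I J K : Type}

lemma Recol.blocks_injective : Function.Injective (Recol.blocks (I := I) (J := J)) :=
  fun _ _ h => Recol.ext h

lemma Recol₃.blocks_injective : Function.Injective (Recol₃.blocks (I := I) (J := J) (K := K)) :=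
  fun _ _ h => Recol₃.ext h

instance [Fintype I] [Fintype J] : Fintype (Recol I J) :=
  Fintype.ofInjective _ Recol.blocks_injective

instance [Fintype I] [Fintype J] [Fintype K] : Fintype (Recol₃ I J K) :=
  Fintype.ofInjective _ Recol₃.blocks_injective

/-- A family `f : B → I ⊔ {∅}` in which every element of `I` occurs exactly once. -/
abbrev IsSeq {B I : Type} (f : B → Option I) : Prop := ∀ i, ∃! b, f b = some i

lemma isSeq_some {I : Type} : IsSeq (some : I → Option I) :=
  fun i => ⟨i, rfl, fun _ h => Option.some_injective _ h⟩

variable {B : Type} [Fintype B]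

open scoped Classical in
/-- The recollement induced by two families: `i` and `j` are glued if they occur at the same
place. -/
def recOf {f : B → Option I} {g : B → Option J} (hf : IsSeq f) (hg : IsSeq g) : Recol I J where
  blocks := (Finset.univ.image fun b => (f b, g b)).erase (none, none)
  none_notMem := by simp
  fst i := by
    obtain ⟨b, hb, hb'⟩ := hf i
    refine ⟨⟨(f b, g b),
      Finset.mem_erase.2 ⟨by simp [hb], Finset.mem_image_of_mem _ (Finset.mem_univ b)⟩⟩, hb, ?_⟩
    rintro ⟨x, hx⟩ hxi
    obtain ⟨b', _, rfl⟩ := Finset.mem_image.1 (Finset.mem_of_mem_erase hx)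
    obtain rfl := hb' b' hxi
    rfl
  snd j := by
    obtain ⟨b, hb, hb'⟩ := hg j
    refine ⟨⟨(f b, g b),
      Finset.mem_erase.2 ⟨by simp [hb], Finset.mem_image_of_mem _ (Finset.mem_univ b)⟩⟩, hb, ?_⟩
    rintro ⟨x, hx⟩ hxi
    obtain ⟨b', _, rfl⟩ := Finset.mem_image.1 (Finset.mem_of_mem_erase hx)
    obtain rfl := hb' b' hxi
    rfl

lemma mem_recOf {f : B → Option I} {g : B → Option J} (hf : IsSeq f) (hg : IsSeq g)
    (x : Option I × Option J) :
    x ∈ (recOf hf hg).blocks ↔ x ≠ (none, none) ∧ ∃ b, (f b, g b) = x := by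
  classical
  simp [recOf]

lemma adapted_recOf {f : B → Option I} {g : B → Option J} (hf : IsSeq f) (hg : IsSeq g) :
    Adapted (none, none) (recOf hf hg).blocks fun b => (f b, g b) where
  base_notMem := (recOf hf hg).none_notMem
  mem b hb := (mem_recOf hf hg _).2 ⟨hb, b, rfl⟩
  unique := by
    rintro ⟨x, y⟩ hx
    obtain ⟨hne, b, hb⟩ := (mem_recOf hf hg _).1 hx
    refine ⟨b, hb, fun b' hb' => ?_⟩
    simp only [Prod.mk.injEq] at hb hb'
    cases x with
    | some i => exact (hf i).unique hb'.1 hb.1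
    | none =>
      cases y with
      | some j => exact (hg j).unique hb'.2 hb.2
      | none => exact absurd rfl hne

lemma eq_recOf {f : B → Option I} {g : B → Option J} (hf : IsSeq f) (hg : IsSeq g)
    {r : Recol I J} (h : Adapted (none, none) r.blocks fun b => (f b, g b)) :
    r = recOf hf hg := by
  apply Recol.ext
  ext x
  rw [mem_recOf]
  constructor
  · intro hx
    refine ⟨?_, (h.unique x hx).exists⟩
    rintro rfl; exact r.none_notMem hx
  · rintro ⟨hne, b, rfl⟩
    exact h.mem b hne

/-- Restriction of a recollement of `I`, `J`, `K` to `I`, `J`. -/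
def Recol₃.π₁₂ (u : Recol₃ I J K) : Recol I J := recOf u.fst u.snd

/-- Restriction of a recollement of `I`, `J`, `K` to `J`, `K`. -/
def Recol₃.π₂₃ (u : Recol₃ I J K) : Recol J K := recOf u.snd u.trd

/-- Restriction of a recollement of `I`, `J`, `K` to `I`, `K`. -/
def Recol₃.π₁₃ (u : Recol₃ I J K) : Recol I K := recOf u.fst u.trd

lemma Recol₃.adapted₁₂ (u : Recol₃ I J K) :
    Adapted (none, none) u.π₁₂.blocks fun y : u.blocks => (y.1.1, y.1.2.1) :=
  adapted_recOf u.fst u.snd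

lemma Recol₃.adapted₂₃ (u : Recol₃ I J K) :
    Adapted (none, none) u.π₂₃.blocks fun y : u.blocks => (y.1.2.1, y.1.2.2) :=
  adapted_recOf u.snd u.trd

lemma Recol₃.adapted₁₃ (u : Recol₃ I J K) :
    Adapted (none, none) u.π₁₃.blocks fun y : u.blocks => (y.1.1, y.1.2.2) :=
  adapted_recOf u.fst u.trd

/-- The number of classes of a recollement. -/
def Recol.card (r : Recol I J) : ℕ := r.blocks.card

/-- The number of classes of a recollement. -/
def Recol₃.card (u : Recol₃ I J K) : ℕ := u.blocks.card

open scoped Classical in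
/-- The recollement induced by three families. -/
def recOf₃ {f : B → Option I} {g : B → Option J} {h : B → Option K} (hf : IsSeq f) (hg : IsSeq g)
    (hh : IsSeq h) : Recol₃ I J K where
  blocks := (Finset.univ.image fun b => (f b, g b, h b)).erase (none, none, none)
  none_notMem := by simp
  fst i := by
    obtain ⟨b, hb, hb'⟩ := hf i
    refine ⟨⟨(f b, g b, h b),
      Finset.mem_erase.2 ⟨by simp [hb], Finset.mem_image_of_mem _ (Finset.mem_univ b)⟩⟩, hb, ?_⟩
    rintro ⟨x, hx⟩ hxi
    obtain ⟨b', _, rfl⟩ := Finset.mem_image.1 (Finset.mem_of_mem_erase hx)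
    obtain rfl := hb' b' hxi
    rfl
  snd j := by
    obtain ⟨b, hb, hb'⟩ := hg j
    refine ⟨⟨(f b, g b, h b),
      Finset.mem_erase.2 ⟨by simp [hb], Finset.mem_image_of_mem _ (Finset.mem_univ b)⟩⟩, hb, ?_⟩
    rintro ⟨x, hx⟩ hxi
    obtain ⟨b', _, rfl⟩ := Finset.mem_image.1 (Finset.mem_of_mem_erase hx)
    obtain rfl := hb' b' hxi
    rfl
  trd j := by
    obtain ⟨b, hb, hb'⟩ := hh j
    refine ⟨⟨(f b, g b, h b),
      Finset.mem_erase.2 ⟨by simp [hb], Finset.mem_image_of_mem _ (Finset.mem_univ b)⟩⟩, hb, ?_⟩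
    rintro ⟨x, hx⟩ hxi
    obtain ⟨b', _, rfl⟩ := Finset.mem_image.1 (Finset.mem_of_mem_erase hx)
    obtain rfl := hb' b' hxi
    rfl

lemma mem_recOf₃ {f : B → Option I} {g : B → Option J} {h : B → Option K} (hf : IsSeq f)
    (hg : IsSeq g) (hh : IsSeq h) (x : Option I × Option J × Option K) :
    x ∈ (recOf₃ hf hg hh).blocks ↔ x ≠ (none, none, none) ∧ ∃ b, (f b, g b, h b) = x := by
  classical
  simp [recOf₃]

lemma adapted_recOf₃ {f : B → Option I} {g : B → Option J} {h : B → Option K} (hf : IsSeq f)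
    (hg : IsSeq g) (hh : IsSeq h) :
    Adapted (none, none, none) (recOf₃ hf hg hh).blocks fun b => (f b, g b, h b) where
  base_notMem := (recOf₃ hf hg hh).none_notMem
  mem b hb := (mem_recOf₃ hf hg hh _).2 ⟨hb, b, rfl⟩
  unique := by
    rintro ⟨x, y, z⟩ hx
    obtain ⟨hne, b, hb⟩ := (mem_recOf₃ hf hg hh _).1 hx
    refine ⟨b, hb, fun b' hb' => ?_⟩
    simp only [Prod.mk.injEq] at hb hb'
    cases x with
    | some i => exact (hf i).unique hb'.1 hb.1
    | none =>
      cases y with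
      | some j => exact (hg j).unique hb'.2.1 hb.2.1
      | none =>
        cases z with
        | some l => exact (hh l).unique hb'.2.2 hb.2.2
        | none => exact absurd rfl hne

lemma eq_recOf₃ {f : B → Option I} {g : B → Option J} {h : B → Option K} (hf : IsSeq f)
    (hg : IsSeq g) (hh : IsSeq h) {u : Recol₃ I J K}
    (hu : Adapted (none, none, none) u.blocks fun b => (f b, g b, h b)) :
    u = recOf₃ hf hg hh := by
  apply Recol₃.ext
  ext x
  rw [mem_recOf₃]
  constructor
  · intro hx
    refine ⟨?_, (hu.unique x hx).exists⟩
    rintro rfl; exact u.none_notMem hx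
  · rintro ⟨hne, b, rfl⟩
    exact hu.mem b hne

section proj
variable {f : B → Option I} {g : B → Option J} {h : B → Option K} (hf : IsSeq f) (hg : IsSeq g)
  (hh : IsSeq h)

lemma π₁₂_recOf₃ : (recOf₃ hf hg hh).π₁₂ = recOf hf hg := by
  apply Recol.ext
  ext x
  rw [mem_recOf, Recol₃.π₁₂, mem_recOf]
  refine and_congr_right fun hne => ⟨?_, ?_⟩
  · rintro ⟨⟨y, hy⟩, rfl⟩
    obtain ⟨_, b, rfl⟩ := (mem_recOf₃ hf hg hh _).1 hy
    exact ⟨b, rfl⟩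
  · rintro ⟨b, rfl⟩
    refine ⟨⟨(f b, g b, h b), (mem_recOf₃ hf hg hh _).2 ⟨?_, b, rfl⟩⟩, rfl⟩
    intro h0; apply hne; simp only [Prod.mk.injEq] at h0 ⊢; tauto

lemma π₂₃_recOf₃ : (recOf₃ hf hg hh).π₂₃ = recOf hg hh := by
  apply Recol.ext
  ext x
  rw [mem_recOf, Recol₃.π₂₃, mem_recOf]
  refine and_congr_right fun hne => ⟨?_, ?_⟩
  · rintro ⟨⟨y, hy⟩, rfl⟩
    obtain ⟨_, b, rfl⟩ := (mem_recOf₃ hf hg hh _).1 hy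
    exact ⟨b, rfl⟩
  · rintro ⟨b, rfl⟩
    refine ⟨⟨(f b, g b, h b), (mem_recOf₃ hf hg hh _).2 ⟨?_, b, rfl⟩⟩, rfl⟩
    intro h0; apply hne; simp only [Prod.mk.injEq] at h0 ⊢; tauto

lemma π₁₃_recOf₃ : (recOf₃ hf hg hh).π₁₃ = recOf hf hh := by
  apply Recol.ext
  ext x
  rw [mem_recOf, Recol₃.π₁₃, mem_recOf]
  refine and_congr_right fun hne => ⟨?_, ?_⟩
  · rintro ⟨⟨y, hy⟩, rfl⟩
    obtain ⟨_, b, rfl⟩ := (mem_recOf₃ hf hg hh _).1 hy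
    exact ⟨b, rfl⟩
  · rintro ⟨b, rfl⟩
    refine ⟨⟨(f b, g b, h b), (mem_recOf₃ hf hg hh _).2 ⟨?_, b, rfl⟩⟩, rfl⟩
    intro h0; apply hne; simp only [Prod.mk.injEq] at h0 ⊢; tauto

end proj

end Recollement

/-! ### The modules `H(U; V)` and their composition -/

section Homs

/-- A unit object of a `k`-linear category: an object whose endomorphism algebra is `k`. -/
structure UnitObj (k : Type w) [CommRing k] (C : Type u) [Category.{v} C] [Preadditive C]
    [Linear k C] where
  obj : C
  bij : Function.Bijective fun c : k => c • 𝟙 obj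

/-- A finite family of objects of `C`. -/
structure Fam (C : Type u) where
  ι : Type
  [fintype : Fintype ι]
  X : ι → C

attribute [instance] Fam.fintype

variable {k : Type w} [CommRing k] {C : Type u} [Category.{v} C] [Preadditive C] [Linear k C]

/-- The identification of `End(𝟏)` with `k`. -/
def UnitObj.scalar (o : UnitObj k C) : (o.obj ⟶ o.obj) →ₗ[k] k :=
  (LinearEquiv.ofBijective (LinearMap.toSpanSingleton k _ (𝟙 o.obj)) o.bij).symm.toLinearMap

lemma UnitObj.scalar_smul (o : UnitObj k C) (a : o.obj ⟶ o.obj) : o.scalar a • 𝟙 o.obj = a :=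
  (LinearEquiv.ofBijective (LinearMap.toSpanSingleton k _ (𝟙 o.obj)) o.bij).apply_symm_apply a

lemma UnitObj.scalar_id (o : UnitObj k C) : o.scalar (𝟙 o.obj) = 1 := by
  apply o.bij.1
  simp only [o.scalar_smul, one_smul]

/-- `U_i` for `i ∈ I ⊔ {∅}`, where `U_∅ = 𝟏`. -/
abbrev Fam.ext (o : UnitObj k C) (U : Fam C) (i : Option U.ι) : C := i.elim o.obj U.X

/-- `Hom(U_i, V_j)` for `i ∈ I ⊔ {∅}` and `j ∈ J ⊔ {∅}`. -/
abbrev homE (o : UnitObj k C) (U V : Fam C) (x : Option U.ι × Option V.ι) : Type v :=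
  U.ext o x.1 ⟶ V.ext o x.2

/-- The identity of `𝟏`, as an element of `Hom(U_∅, V_∅)`. -/
abbrev homE.e (o : UnitObj k C) (U V : Fam C) : homE o U V (none, none) := 𝟙 o.obj

/-- The identification of `Hom(U_∅, V_∅) = End(𝟏)` with `k`. -/
def homE.sc (o : UnitObj k C) (U V : Fam C) : homE o U V (none, none) →ₗ[k] k := o.scalar

lemma homE.sc_e (o : UnitObj k C) (U V : Fam C) : homE.sc o U V (homE.e o U V) = 1 := o.scalar_id

lemma homE.sc_smul (o : UnitObj k C) (U V : Fam C) (a : homE o U V (none, none)) :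
    homE.sc o U V a • homE.e o U V = a := o.scalar_smul a

/-- `H_r(U_I; V_J)`, the tensor product of the modules `Hom(U_i, V_j)` over `(i, j) ∈ r`. -/
abbrev Hr (o : UnitObj k C) (U V : Fam C) (r : Recol U.ι V.ι) : Type (max w v) :=
  ⨂[k] x : r.blocks, homE o U V x

/-- `H(U_I; V_J)`, the direct sum of the modules `H_r(U_I; V_J)` over all recollements `r`. -/
abbrev HH (o : UnitObj k C) (U V : Fam C) : Type (max w v) := ∀ r : Recol U.ι V.ι, Hr o U V r

/-- The summand `H^{>d}(U_I; V_J)`. -/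
def HHgt (o : UnitObj k C) (U V : Fam C) (d : ℕ) : Submodule k (HH o U V) where
  carrier := {Φ | ∀ r : Recol U.ι V.ι, r.card ≤ d → Φ r = 0}
  add_mem' ha hb r hr := by simp [ha r hr, hb r hr]
  zero_mem' r _ := rfl
  smul_mem' c a ha r hr := by simp [ha r hr]

variable (o : UnitObj k C) {U V W : Fam C}

/-- The composition `(Φ, Ψ) ↦ Ψ ∘_u Φ` along `u ∈ R(I, J, K)`: for every class `(i, j, k)` of `u`
the factors in `Hom(U_i, V_j)` and `Hom(V_j, W_k)` are composed, and the composites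
`𝟏 → V_j → 𝟏` with `i = k = ∅` are turned into scalars. -/
def compU (u : Recol₃ U.ι V.ι W.ι) :
    Hr o U V u.π₁₂ →ₗ[k] Hr o V W u.π₂₃ →ₗ[k] Hr o U W u.π₁₃ :=
  ((compT k (fun y : u.blocks => U.ext o y.1.1) (fun y => V.ext o y.1.2.1)
      (fun y => W.ext o y.1.2.2)).compl₁₂
    (ins k (E := homE o U V) (homE.e o U V) u.adapted₁₂)
    (ins k (E := homE o V W) (homE.e o V W) u.adapted₂₃)).compr₂
    (con k (E := homE o U W) (o := (none, none)) (homE.sc o U W)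
      u.adapted₁₃)

lemma compU_apply (u : Recol₃ U.ι V.ι W.ι) (Φ : Hr o U V u.π₁₂) (Ψ : Hr o V W u.π₂₃) :
    compU o u Φ Ψ =
      con k (E := homE o U W) (o := (none, none)) (homE.sc o U W) u.adapted₁₃
        (compT k (fun y : u.blocks => U.ext o y.1.1) (fun y => V.ext o y.1.2.1)
          (fun y => W.ext o y.1.2.2)
          (ins k (E := homE o U V) (homE.e o U V) u.adapted₁₂ Φ)
          (ins k (E := homE o V W) (homE.e o V W) u.adapted₂₃ Ψ)) := rfl

/-- The coefficient `P_u(t) = ∏ (t - a)`, over `#π₁₃(u) ≤ a < #u`. -/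
def Recol₃.P {I J K : Type} (u : Recol₃ I J K) (t : k) : k :=
  ∏ a ∈ Finset.Ico u.π₁₃.card u.card, (t - (a : k))

open scoped Classical in
/-- The composition in rank `t`: the component of `Ψ ∘ Φ` is the sum over all `u ∈ R(I, J, K)` of
`P_u(t) (Ψ_{π₂₃(u)} ∘_u Φ_{π₁₂(u)})`, placed in the summand with index `π₁₃(u)`. -/
def compH (t : k) (Φ : HH o U V) (Ψ : HH o V W) : HH o U W :=
  ∑ u : Recol₃ U.ι V.ι W.ι, u.P t • Pi.single u.π₁₃ (compU o u (Φ u.π₁₂) (Ψ u.π₂₃))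

/-- The recollement `{(i, i) | i ∈ I}`. -/
def Recol.diag (I : Type) [Fintype I] : Recol I I :=
  recOf (isSeq_some (I := I)) (isSeq_some (I := I))

lemma Recol.diag_eq {I : Type} [Fintype I] (x : (Recol.diag I).blocks) : x.1.1 = x.1.2 := by
  obtain ⟨_, b, hb⟩ := (mem_recOf _ _ _).1 x.2
  rw [← hb]

open scoped Classical in
/-- The identity of `U_I` in rank `t`: the tensor product of the identities of the `U_i`. -/
def idH (U : Fam C) : HH o U U :=
  Pi.single (Recol.diag U.ι) (PiTensorProduct.tprod k fun x =>
    eqToHom (congrArg (U.ext o) (Recol.diag_eq x)))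

end Homs

/-! ### Well-definedness of the composition -/

section Poly
variable {k : Type w} [CommRing k] {M M' : Type*} [AddCommGroup M] [Module k M] [AddCommGroup M']
  [Module k M']

/-- Functions on `ℕ` whose `n`-th difference vanishes. -/
def PolyDeg : ℕ → (ℕ → M) → Prop
  | 0, F => F = 0
  | n + 1, F => PolyDeg n fun N => F (N + 1) - F N

lemma PolyDeg.zero (n : ℕ) : PolyDeg n (0 : ℕ → M) := by
  induction n with
  | zero => rfl
  | succ n ih =>
    have : (fun N => (0 : ℕ → M) (N + 1) - (0 : ℕ → M) N) = 0 := by funext N; simp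
    simp only [PolyDeg]; rw [this]; exact ih

lemma PolyDeg.succ {n : ℕ} {F : ℕ → M} (h : PolyDeg n F) : PolyDeg (n + 1) F := by
  induction n generalizing F with
  | zero => cases h; exact PolyDeg.zero 1
  | succ n ih => exact ih h

lemma PolyDeg.mono {n m : ℕ} (hnm : n ≤ m) {F : ℕ → M} (h : PolyDeg n F) : PolyDeg m F := by
  induction hnm with
  | refl => exact h
  | step _ ih => exact ih.succ

lemma PolyDeg.add {n : ℕ} {F G : ℕ → M} (hF : PolyDeg n F) (hG : PolyDeg n G) :
    PolyDeg n (F + G) := by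
  induction n generalizing F G with
  | zero => cases hF; cases hG; exact add_zero _
  | succ n ih =>
    have := ih hF hG
    have h2 : (fun N => (F + G) (N + 1) - (F + G) N) =
      (fun N => F (N + 1) - F N) + fun N => G (N + 1) - G N := by funext N; simp; abel
    simp only [PolyDeg]; rw [h2]; exact this

lemma PolyDeg.map {n : ℕ} {F : ℕ → M} (hF : PolyDeg n F) (L : M →ₗ[k] M') :
    PolyDeg n fun N => L (F N) := by
  induction n generalizing F with
  | zero => cases hF; funext N; simp
  | succ n ih =>
    have := ih hF
    simpa only [PolyDeg, map_sub] using this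

lemma PolyDeg.mul {n : ℕ} {F : ℕ → M} (hF : PolyDeg n F) (a : k) :
    PolyDeg (n + 1) fun N => ((N : k) - a) • F N := by
  induction n generalizing F with
  | zero => cases hF; convert! PolyDeg.zero (M := M) 1 using 1; funext N; simp
  | succ n ih =>
    have h1 := ih hF
    have h2 := (h1.add (PolyDeg.succ hF)).add hF
    have h3 : (fun N : ℕ => (((N + 1 : ℕ) : k) - a) • F (N + 1) - ((N : k) - a) • F N) =
      ((fun N : ℕ => ((N : k) - a) • (F (N + 1) - F N)) + fun N => F (N + 1) - F N) + F := by
      funext N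
      simp only [Nat.cast_add, Nat.cast_one, Pi.add_apply]
      module
    change PolyDeg (n + 1)
      (fun N : ℕ => (((N + 1 : ℕ) : k) - a) • F (N + 1) - ((N : k) - a) • F N)
    rw [h3]
    exact h2

lemma PolyDeg.eq_zero {n : ℕ} {F : ℕ → M} (hF : PolyDeg n F) {N₀ : ℕ}
    (h : ∀ N, N₀ ≤ N → F N = 0) : F = 0 := by
  induction n generalizing F with
  | zero => exact hF
  | succ n ih =>
    have h1 := ih hF (fun N hN => by rw [h N hN, h (N + 1) (by omega), sub_zero])
    have h2 : ∀ N, F (N + 1) = F N := fun N => sub_eq_zero.1 (congrFun h1 N)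
    have h3 : ∀ N, F N = F 0 := by
      intro N; induction N with
      | zero => rfl
      | succ N ihN => rw [h2, ihN]
    funext N
    rw [h3, ← h3 N₀, h N₀ le_rfl]; rfl

/-- Functions on `ℕ` of polynomial type. -/
def IsPoly (F : ℕ → M) : Prop := ∃ n, PolyDeg n F

lemma IsPoly.const (m : M) : IsPoly fun _ => m := ⟨1, by simp only [PolyDeg]; funext; simp⟩

lemma IsPoly.add {F G : ℕ → M} (hF : IsPoly F) (hG : IsPoly G) : IsPoly (F + G) := by
  obtain ⟨n, hn⟩ := hF
  obtain ⟨m, hm⟩ := hG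
  exact ⟨max n m, (hn.mono (le_max_left _ _)).add (hm.mono (le_max_right _ _))⟩

lemma IsPoly.map {F : ℕ → M} (hF : IsPoly F) (L : M →ₗ[k] M') : IsPoly fun N => L (F N) :=
  hF.imp fun _ h => h.map L

lemma IsPoly.sum {ι : Type*} (s : Finset ι) {F : ι → ℕ → M} (hF : ∀ i, IsPoly (F i)) :
    IsPoly fun N => ∑ i ∈ s, F i N := by
  classical
  induction s using Finset.induction_on with
  | empty => simpa using IsPoly.const (0 : M)
  | insert i s hi ih => simpa [Finset.sum_insert hi] using! (hF i).add ih

lemma IsPoly.prod_smul (s : Finset ℕ) {F : ℕ → M} (hF : IsPoly F) :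
    IsPoly fun N => (∏ a ∈ s, ((N : k) - (a : k))) • F N := by
  classical
  induction s using Finset.induction_on with
  | empty => simpa using hF
  | insert i s hi ih =>
    obtain ⟨n, hn⟩ := ih
    refine ⟨n + 1, ?_⟩
    simpa [Finset.prod_insert hi, mul_smul] using hn.mul (i : k)

lemma IsPoly.eq_zero {F : ℕ → M} (hF : IsPoly F) {N₀ : ℕ}
    (h : ∀ N, N₀ ≤ N → F N = 0) (N : ℕ) : F N = 0 := by
  obtain ⟨n, hn⟩ := hF
  rw [hn.eq_zero h]; rfl

end Poly

section Count

variable {I J K : Type} {N : ℕ}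

/-- The sequences of length `N` in `I ⊔ {∅}` in which every element of `I` occurs exactly once. -/
abbrev Seq (N : ℕ) (I : Type) : Type := {f : Fin N → Option I // IsSeq f}

lemma exists_adapted {X : Type} (o : X) (r : Finset X) (ho : o ∉ r) (h : r.card ≤ N) :
    ∃ L : Fin N → X, Adapted o r L := by
  classical
  obtain ⟨e⟩ := Function.Embedding.nonempty_of_card_le (α := r) (β := Fin N) (by simpa using h)
  refine ⟨fun a => if h : ∃ x : r, e x = a then h.choose else o, ho, ?_, ?_⟩
  · intro b hb
    by_cases h : ∃ x : r, e x = b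
    · simp only [h, dif_pos]; exact h.choose.2
    · simp [h] at hb
  · intro x hx
    refine ⟨e ⟨x, hx⟩, ?_, ?_⟩
    · have h : ∃ y : r, e y = e ⟨x, hx⟩ := ⟨_, rfl⟩
      simp only [h, dif_pos]
      rw [e.injective h.choose_spec]
    · intro b hb
      by_cases h : ∃ x : r, e x = b
      · simp only [h, dif_pos] at hb
        rw [← h.choose_spec]
        congr 1
        exact Subtype.ext hb
      · simp only [h, dif_neg, not_false_eq_true] at hb
        exact absurd (hb ▸ hx) ho

lemma Adapted.isSeq {B X A : Type} {o : X} {r : Finset X} {L : B → X} (h : Adapted o r L)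
    (π : X → Option A) (hπ : π o = none) (hr : ∀ i, ∃! x : r, π x = some i) :
    IsSeq fun b => π (L b) := by
  intro i
  obtain ⟨x, hx, hx'⟩ := hr i
  obtain ⟨b, hb, hb'⟩ := h.unique x x.2
  refine ⟨b, by dsimp only; rw [hb, hx], ?_⟩
  intro b₂ h₂
  dsimp only at h₂
  have hm : L b₂ ∈ r := h.mem b₂ (fun h3 => by rw [h3, hπ] at h₂; simp at h₂)
  have := hx' ⟨L b₂, hm⟩ h₂
  exact hb' b₂ (by rw [← this])

lemma exists_recOf (r : Recol I J) (h : r.card ≤ N) :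
    ∃ (f : Seq N I) (g : Seq N J), Adapted (none, none) r.blocks fun a => (f.1 a, g.1 a) := by
  obtain ⟨L, hL⟩ := exists_adapted (none, none) r.blocks r.none_notMem h
  exact ⟨⟨_, hL.isSeq Prod.fst rfl r.fst⟩, ⟨_, hL.isSeq Prod.snd rfl r.snd⟩, hL⟩

lemma adapted_comp₁₂ {B : Type} {f : B → Option I} {g : B → Option J} {h : B → Option K}
    [Fintype B]
    {u : Recol₃ I J K} (hf : IsSeq f) (hg : IsSeq g) (hh : IsSeq h)
    (hu : Adapted (none, none, none) u.blocks fun b => (f b, g b, h b)) :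
    Adapted (none, none) u.π₁₂.blocks fun b => (f b, g b) := by
  rw [eq_recOf₃ hf hg hh hu, π₁₂_recOf₃]; exact adapted_recOf _ _

lemma adapted_comp₂₃ {B : Type} {f : B → Option I} {g : B → Option J} {h : B → Option K}
    [Fintype B]
    {u : Recol₃ I J K} (hf : IsSeq f) (hg : IsSeq g) (hh : IsSeq h)
    (hu : Adapted (none, none, none) u.blocks fun b => (f b, g b, h b)) :
    Adapted (none, none) u.π₂₃.blocks fun b => (g b, h b) := by
  rw [eq_recOf₃ hf hg hh hu, π₂₃_recOf₃]; exact adapted_recOf _ _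

lemma adapted_comp₁₃ {B : Type} {f : B → Option I} {g : B → Option J} {h : B → Option K}
    [Fintype B]
    {u : Recol₃ I J K} (hf : IsSeq f) (hg : IsSeq g) (hh : IsSeq h)
    (hu : Adapted (none, none, none) u.blocks fun b => (f b, g b, h b)) :
    Adapted (none, none) u.π₁₃.blocks fun b => (f b, h b) := by
  rw [eq_recOf₃ hf hg hh hu, π₁₃_recOf₃]; exact adapted_recOf _ _

/-- An adapted family takes values different from the base point at exactly `#r` places. -/
lemma Adapted.card_eq {B X : Type} [Fintype B] {o : X} {r : Finset X} {L : B → X}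
    (h : Adapted o r L) [DecidablePred fun b => L b ≠ o] :
    (Finset.univ.filter fun b => L b ≠ o).card = r.card := by
  refine Finset.card_bij (fun b _ => L b) ?_ ?_ ?_
  · intro b hb; exact h.mem b (Finset.mem_filter.1 hb).2
  · intro b hb b' hb' e
    obtain ⟨c, _, hc⟩ := h.unique (L b) (h.mem b (Finset.mem_filter.1 hb).2)
    rw [hc b rfl, hc b' e.symm]
  · intro y hy
    obtain ⟨b, hb, _⟩ := h.unique y hy
    refine ⟨b, Finset.mem_filter.2 ⟨Finset.mem_univ _, ?_⟩, hb⟩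
    rw [hb]; rintro rfl; exact h.base_notMem hy

lemma cast_descFactorial_eq {k : Type w} [CommRing k] (F j : ℕ) :
    ((F.descFactorial j : ℕ) : k) = ∏ i ∈ Finset.range j, ((F : k) - (i : k)) := by
  induction j with
  | zero => simp
  | succ j ih =>
    rw [Nat.descFactorial_succ, Finset.prod_range_succ, ← ih]
    by_cases h : j ≤ F
    · push_cast [Nat.cast_sub h]; ring
    · rw [Nat.descFactorial_of_lt (by omega)]; simp

open scoped Classical in
/-- The number of sequences completing two given ones to a family adapted to `u`. -/
lemma card_completions {k : Type w} [CommRing k] [Fintype J] (u : Recol₃ I J K) (f : Seq N I) (h : Seq N K)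
    (hu : u.π₁₃ = recOf f.2 h.2) :
    (((Finset.univ.filter fun g : Seq N J => recOf₃ f.2 g.2 h.2 = u).card : ℕ) : k) =
      u.P (N : k) := by
  have hfh : Adapted (none, none) u.π₁₃.blocks fun a => (f.1 a, h.1 a) := by
    rw [hu]; exact adapted_recOf _ _
  have hub : Adapted (none, none) u.π₁₃.blocks fun y : u.blocks => (y.1.1, y.1.2.2) :=
    adapted_recOf u.fst u.trd
  let O := {y : u.blocks // (y.1.1, y.1.2.2) = (none, none)}
  let Fr := {a : Fin N // (f.1 a, h.1 a) = (none, none)}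
  have hO : u.π₁₃.card + Fintype.card O = u.card := by
    have h1 := hub.card_eq
    have h2 := Finset.card_filter_add_card_filter_not (s := (Finset.univ : Finset u.blocks))
      (fun y : u.blocks => (y.1.1, y.1.2.2) = (none, none))
    rw [Fintype.card_subtype]
    simp only [Finset.card_univ, Fintype.card_coe] at h2
    simp only [Recol.card, Recol₃.card]
    simp only [ne_eq] at h1
    omega
  have hF : u.π₁₃.card + Fintype.card Fr = N := by
    have h1 := hfh.card_eq
    have h2 := Finset.card_filter_add_card_filter_not (s := (Finset.univ : Finset (Fin N)))
      (fun a : Fin N => (f.1 a, h.1 a) = (none, none))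
    rw [Fintype.card_subtype]
    simp only [Finset.card_univ, Fintype.card_fin] at h2
    simp only [Recol.card]
    simp only [ne_eq] at h1
    omega
  have hP : u.P (N : k) = ((Fintype.card (O ↪ Fr) : ℕ) : k) := by
    rw [Fintype.card_embedding_eq, cast_descFactorial_eq, Recol₃.P,
      Finset.prod_Ico_eq_prod_range]
    refine Finset.prod_congr (by congr 1; omega) fun i _ => ?_
    conv_lhs => rw [← hF]
    push_cast; ring
  rw [hP]
  congr 1
  rw [← Fintype.card_subtype]
  have had : ∀ g : {g : Seq N J // recOf₃ f.2 g.2 h.2 = u},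
      Adapted (none, none, none) u.blocks fun b => (f.1 b, g.1.1 b, h.1 b) := by
    rintro ⟨g, rfl⟩; exact adapted_recOf₃ _ _ _
  refine Fintype.card_congr (Equiv.ofBijective (fun g =>
    (⟨fun y => ⟨(had g).pos y.1, ?_⟩, ?_⟩ : O ↪ Fr)) ⟨?_, ?_⟩)
  · have h1 := (had g).p_pos y.1
    have h2 := y.2
    rw [← h1] at h2
    exact h2
  · intro y y' hy
    have h1 := (had g).p_pos y.1
    have h2 := (had g).p_pos y'.1
    have h3 := congrArg Subtype.val hy
    dsimp only at h3
    rw [h3] at h1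
    exact Subtype.ext (Subtype.ext (h1.symm.trans h2))
  · intro g g' hgg
    have hpos : ∀ y : O, (had g).pos y.1 = (had g').pos y.1 := fun y =>
      congrArg Subtype.val (DFunLike.congr_fun hgg y)
    have key : ∀ (g g' : {g : Seq N J // recOf₃ f.2 g.2 h.2 = u}),
        (∀ y : O, (had g).pos y.1 = (had g').pos y.1) →
        ∀ a j, g.1.1 a = some j → g'.1.1 a = some j := by
      intro g g' hpos a j hj
      have hm : (f.1 a, g.1.1 a, h.1 a) ∈ u.blocks := (had g).mem a (by simp [hj])
      by_cases ha : (f.1 a, h.1 a) = (none, none)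
      · have h1 := hpos ⟨⟨_, hm⟩, ha⟩
        rw [(had g).pos_eq ⟨_, hm⟩ rfl] at h1
        have h2 := (had g').p_pos ⟨_, hm⟩
        rw [← h1] at h2
        simp only [Prod.mk.injEq] at h2
        rw [h2.2.1, hj]
      · have hm' : (f.1 a, g'.1.1 a, h.1 a) ∈ u.blocks := (had g').mem a (by
          intro h0; apply ha; simp only [Prod.mk.injEq] at h0 ⊢; tauto)
        have h1 := (hub.unique _ (hfh.mem a ha)).unique (y₁ := ⟨_, hm⟩) (y₂ := ⟨_, hm'⟩) rfl rfl
        have h2 := congrArg Subtype.val h1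
        simp only [Prod.mk.injEq] at h2
        rw [← h2.2.1, hj]
    apply Subtype.ext
    apply Subtype.ext
    funext a
    have h1 := key g g' hpos a
    have h2 := key g' g (fun y => (hpos y).symm) a
    cases hg : g.1.1 a with
    | some j => rw [h1 j hg]
    | none =>
      cases hg' : g'.1.1 a with
      | some j => rw [h2 j hg'] at hg; simp at hg
      | none => rfl
  · intro e
    have hex : ∀ a, (f.1 a, h.1 a) ≠ (none, none) →
        ∃ y : u.blocks, (y.1.1, y.1.2.2) = (f.1 a, h.1 a) := fun a ha =>
      (hub.unique _ (hfh.mem a ha)).exists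
    let L : Fin N → Option I × Option J × Option K := fun a =>
      if ha : (f.1 a, h.1 a) = (none, none) then
        if hy : ∃ y : O, (e y).1 = a then hy.choose.1.1 else (none, none, none)
      else (hex a ha).choose.1
    have hL : ∀ a, ((L a).1, (L a).2.2) = (f.1 a, h.1 a) := by
      intro a
      by_cases ha : (f.1 a, h.1 a) = (none, none)
      · by_cases hy : ∃ y : O, (e y).1 = a
        · simp only [L, ha, dif_pos, hy]; exact hy.choose.2
        · simp only [L, ha, dif_pos, hy, dif_neg, not_false_eq_true]
      · have : L a = (hex a ha).choose.1 := by
          simp only [L]; rw [dif_neg ha]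
        rw [this]; exact (hex a ha).choose_spec
    have hLa : Adapted (none, none, none) u.blocks L := by
      refine ⟨u.none_notMem, ?_, ?_⟩
      · intro a h0
        by_cases ha : (f.1 a, h.1 a) = (none, none)
        · by_cases hy : ∃ y : O, (e y).1 = a
          · simp only [L, ha, dif_pos, hy]; exact hy.choose.1.2
          · simp only [L, ha, dif_pos, hy, dif_neg, not_false_eq_true] at h0
            exact absurd rfl h0
        · have : L a = (hex a ha).choose.1 := by
            simp only [L]; rw [dif_neg ha]
          rw [this]; exact (hex a ha).choose.2
      · intro y hy
        by_cases hy0 : (y.1, y.2.2) = (none, none)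
        · have hLe : ∀ y : O, L (e y).1 = y.1.1 := by
            intro y
            have h1 : (f.1 (e y).1, h.1 (e y).1) = (none, none) := (e y).2
            have h2 : ∃ y' : O, (e y').1 = (e y).1 := ⟨y, rfl⟩
            simp only [L]
            rw [dif_pos h1, dif_pos h2]
            rw [e.injective (Subtype.ext h2.choose_spec)]
          refine ⟨(e ⟨⟨y, hy⟩, hy0⟩).1, hLe _, ?_⟩
          intro a ha
          have h1 : (f.1 a, h.1 a) = (none, none) := by rw [← hL a, ha, hy0]
          by_cases h2 : ∃ y : O, (e y).1 = a
          · have h3 : L a = h2.choose.1.1 := by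
              simp only [L]; rw [dif_pos h1, dif_pos h2]
            rw [← h2.choose_spec]
            congr 2
            apply Subtype.ext
            apply Subtype.ext
            rw [← h3, ha]
          · have h3 : L a = (none, none, none) := by
              simp only [L]; rw [dif_pos h1, dif_neg h2]
            rw [h3] at ha
            exact absurd (ha ▸ hy) u.none_notMem
        · have hm : (y.1, y.2.2) ∈ u.π₁₃.blocks := hub.mem ⟨y, hy⟩ hy0
          obtain ⟨a, ha, ha'⟩ := hfh.unique _ hm
          refine ⟨a, ?_, ?_⟩
          · have h0 : (f.1 a, h.1 a) ≠ (none, none) := by rw [ha]; exact hy0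
            have : L a = (hex a h0).choose.1 := by
              simp only [L]; rw [dif_neg h0]
            change L a = y
            rw [this]
            have h1 := (hub.unique _ hm).unique (y₁ := (hex a h0).choose) (y₂ := ⟨y, hy⟩)
              ((hex a h0).choose_spec.trans ha) rfl
            rw [h1]
          · intro a₂ h₂
            exact ha' a₂ (by dsimp only; rw [← hL a₂, h₂])
    have hg : IsSeq fun a => (L a).2.1 := hLa.isSeq (fun x => x.2.1) rfl u.snd
    have hLeq : (fun a => (f.1 a, (L a).2.1, h.1 a)) = L := by
      funext a
      have := hL a
      simp only [Prod.mk.injEq] at this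
      rw [← this.1, ← this.2]
    have hgu : recOf₃ f.2 hg h.2 = u := by
      symm
      apply eq_recOf₃
      rw [hLeq]; exact hLa
    refine ⟨⟨⟨_, hg⟩, hgu⟩, ?_⟩
    ext y
    have h1 : (had ⟨⟨_, hg⟩, hgu⟩).pos y.1 = (e y).1 := by
      apply Adapted.pos_eq
      have := congrFun hLeq (e y).1
      refine this.trans ?_
      have h1 : (f.1 (e y).1, h.1 (e y).1) = (none, none) := (e y).2
      have h2 : ∃ y' : O, (e y').1 = (e y).1 := ⟨y, rfl⟩
      simp only [L]
      rw [dif_pos h1, dif_pos h2]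
      rw [e.injective (Subtype.ext h2.choose_spec)]
    exact congrArg Fin.val h1

end Count

section Matrices

variable {k : Type w} [CommRing k] {C : Type u} [Category.{v} C] [Preadditive C] [Linear k C]
  (o : UnitObj k C) {U V W X : Fam C} {N : ℕ}

/-- The entry of `[Φ]` at the cell `U_{i₁} ⊠ ⋯ ⊠ U_{i_N} → V_{j₁} ⊠ ⋯ ⊠ V_{j_N}`: if `r` is the
recollement to which `((i₁, j₁), …, (i_N, j_N))` is adapted, it is the component of `Φ` in
`H_r(U; V)`, with its factors reordered and the identity of `𝟏` inserted at each `(∅, ∅)`. -/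
def entry (f : Seq N U.ι) (g : Seq N V.ι) :
    HH o U V →ₗ[k] ⨂[k] a, (U.ext o (f.1 a) ⟶ V.ext o (g.1 a)) :=
  (ins k (E := homE o U V) (homE.e o U V) (adapted_recOf f.2 g.2)).comp
    (LinearMap.proj (recOf f.2 g.2))

lemma entry_eq {f : Seq N U.ι} {g : Seq N V.ι} {r : Recol U.ι V.ι}
    (h : Adapted (none, none) r.blocks fun a => (f.1 a, g.1 a)) (Φ : HH o U V) :
    entry o f g Φ = ins k (E := homE o U V) (homE.e o U V) h (Φ r) := by
  obtain rfl := eq_recOf f.2 g.2 h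
  rfl

open scoped Classical in
lemma entry_single {f : Seq N U.ι} {g : Seq N V.ι} {r : Recol U.ι V.ι}
    (h : Adapted (none, none) r.blocks fun a => (f.1 a, g.1 a)) (x : Hr o U V r) :
    entry o f g (Pi.single r x) = ins k (E := homE o U V) (homE.e o U V) h x := by
  rw [entry_eq o h, Pi.single_eq_same]

open scoped Classical in
lemma entry_single_ne {f : Seq N U.ι} {g : Seq N V.ι} {r : Recol U.ι V.ι}
    (h : r ≠ recOf f.2 g.2) (x : Hr o U V r) : entry o f g (Pi.single r x) = 0 := by
  simp only [entry, LinearMap.comp_apply, LinearMap.proj_apply]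
  rw [Pi.single_eq_of_ne h.symm, map_zero]

/-- An element of `H(U; V)` is determined by its entries, if the rank is large. -/
lemma eq_zero_of_entry {Φ : HH o U V} (hN : ∀ r : Recol U.ι V.ι, r.card ≤ N)
    (h : ∀ (f : Seq N U.ι) (g : Seq N V.ι), entry o f g Φ = 0) : Φ = 0 := by
  funext r
  obtain ⟨f, g, hfg⟩ := exists_recOf r (hN r)
  have h1 := h f g
  rw [entry_eq o hfg] at h1
  have h2 := con_ins (E := homE o U V) (homE.e o U V) (homE.sc o U V) (homE.sc_e o U V) hfg (Φ r)
  rw [h1, map_zero] at h2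
  exact h2.symm

/-- Composition along `u` is compatible with the insertion of identities. -/
lemma compT_ins (u : Recol₃ U.ι V.ι W.ι) (f : Seq N U.ι) (g : Seq N V.ι) (h : Seq N W.ι)
    (hu : Adapted (none, none, none) u.blocks fun a => (f.1 a, g.1 a, h.1 a))
    (Φ : Hr o U V u.π₁₂) (Ψ : Hr o V W u.π₂₃) :
    compT k (fun a => U.ext o (f.1 a)) (fun a => V.ext o (g.1 a)) (fun a => W.ext o (h.1 a))
      (ins k (E := homE o U V) (homE.e o U V) (adapted_comp₁₂ f.2 g.2 h.2 hu) Φ)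
      (ins k (E := homE o V W) (homE.e o V W) (adapted_comp₂₃ f.2 g.2 h.2 hu) Ψ) =
    ins k (E := homE o U W) (homE.e o U W) (adapted_comp₁₃ f.2 g.2 h.2 hu) (compU o u Φ Ψ) := by
  induction Φ using PiTensorProduct.induction_on with
  | add Φ Φ' h h' => simp only [map_add, LinearMap.add_apply, h, h']
  | smul_tprod c φ =>
  induction Ψ using PiTensorProduct.induction_on with
  | add Φ Φ' h h' => simp only [map_add, h, h']
  | smul_tprod c' ψ =>
    simp only [map_smul, LinearMap.smul_apply]
    congr 2
    rw [compU_apply, ins_tprod, ins_tprod, ins_tprod, ins_tprod]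
    have := ins_con_relabel (k := k) (E := homE o U W) (homE.e o U W) (homE.sc o U W)
      (homE.sc_e o U W) (homE.sc_smul o U W)
      (Y := Option U.ι × Option V.ι × Option W.ι) (oY := (none, none, none))
      (u := u.blocks) (π := fun y => (y.1, y.2.2)) rfl u.adapted₁₃ hu
      (adapted_comp₁₃ f.2 g.2 h.2 hu)
      (fun y => hat k (E := homE o U V) (homE.e o U V) u.π₁₂.blocks φ (y.1, y.2.1) ≫
        hat k (E := homE o V W) (homE.e o V W) u.π₂₃.blocks ψ (y.2.1, y.2.2)) (by
          simp only [castE_rfl]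
          rw [hat_base _ u.π₁₂.none_notMem, hat_base _ u.π₂₃.none_notMem]
          exact Category.comp_id _)
    refine (compT_tprod _ _ _ _ _).trans (this.symm.trans ?_)
    refine congrArg (ins k (E := homE o U W) (homE.e o U W) (adapted_comp₁₃ f.2 g.2 h.2 hu)) ?_
    refine congrArg (con k (E := homE o U W) (homE.sc o U W) u.adapted₁₃) ?_
    exact (compT_tprod _ _ _ _ _).symm

open scoped Classical in
/-- The composition law. -/
lemma entry_compH (f : Seq N U.ι) (h : Seq N W.ι) (Φ : HH o U V) (Ψ : HH o V W) :
    entry o f h (compH o (N : k) Φ Ψ) =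
      ∑ g : Seq N V.ι, compT k (fun a => U.ext o (f.1 a)) (fun a => V.ext o (g.1 a))
        (fun a => W.ext o (h.1 a)) (entry o f g Φ) (entry o g h Ψ) := by
  let Y : Recol₃ U.ι V.ι W.ι → ⨂[k] a, (U.ext o (f.1 a) ⟶ W.ext o (h.1 a)) := fun u =>
    entry o f h (Pi.single u.π₁₃ (compU o u (Φ u.π₁₂) (Ψ u.π₂₃)))
  have h1 : ∀ g : Seq N V.ι, compT k (fun a => U.ext o (f.1 a)) (fun a => V.ext o (g.1 a))
        (fun a => W.ext o (h.1 a)) (entry o f g Φ) (entry o g h Ψ) = Y (recOf₃ f.2 g.2 h.2) := by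
    intro g
    have hu := adapted_recOf₃ f.2 g.2 h.2
    rw [entry_eq o (adapted_comp₁₂ f.2 g.2 h.2 hu), entry_eq o (adapted_comp₂₃ f.2 g.2 h.2 hu),
      compT_ins o _ f g h hu]
    simp only [Y]
    rw [entry_single o (adapted_comp₁₃ f.2 g.2 h.2 hu)]
  rw [Finset.sum_congr rfl fun g _ => h1 g]
  rw [← Finset.sum_fiberwise_of_maps_to (s := Finset.univ) (t := Finset.univ)
    (g := fun g : Seq N V.ι => recOf₃ f.2 g.2 h.2) (fun _ _ => Finset.mem_univ _)]
  simp only [compH, map_sum, map_smul]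
  refine Finset.sum_congr rfl fun u _ => ?_
  rw [Finset.sum_congr rfl (g := fun _ => Y u) (fun g hg => by rw [(Finset.mem_filter.1 hg).2]),
    Finset.sum_const]
  by_cases hu : u.π₁₃ = recOf f.2 h.2
  · rw [← card_completions (k := k) u f h hu, Nat.cast_smul_eq_nsmul]
  · simp only [Y]
    rw [entry_single_ne o hu, smul_zero]
    exact (nsmul_zero _).symm

open scoped Classical in
/-- The underlying object of `[U_I]`: the direct sum of the objects `U_{i₁} ⊠ ⋯ ⊠ U_{i_N}` over all
sequences in `I ⊔ {∅}` in which every element of `I` occurs exactly once. It is the zero object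
if `#I > N`. -/
def brMatObj (N : ℕ) (U : Fam C) : Mat_ (TP k C N) where
  ι := Seq N U.ι
  X f := ⟨fun a => U.ext o (f.1 a)⟩

/-- The matrix of `[Φ]`. -/
def brMat (N : ℕ) : HH o U V →ₗ[k] (brMatObj o N U ⟶ brMatObj o N V) where
  toFun Φ := fun f g => entry o f g Φ
  map_add' Φ Φ' := by funext f g; exact map_add (entry o f g) Φ Φ'
  map_smul' c Φ := by funext f g; exact map_smul (entry o f g) c Φ

lemma brMat_comp (Φ : HH o U V) (Ψ : HH o V W) :
    brMat o N (compH o (N : k) Φ Ψ) = brMat o N Φ ≫ brMat o N Ψ := by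
  apply Mat_.hom_ext
  intro f h
  exact entry_compH o f h Φ Ψ

lemma brMat_id (U : Fam C) : brMat o N (idH o U) = 𝟙 (brMatObj o N U) := by
  classical
  apply Mat_.hom_ext
  intro (f : Seq N U.ι) (g : Seq N U.ι)
  change entry o f g (idH o U) = _
  by_cases hfg : f = g
  · subst hfg
    refine Eq.trans ?_ (Mat_.id_apply_self (brMatObj o N U) f).symm
    have had : Adapted (none, none) (Recol.diag U.ι).blocks fun a => (f.1 a, f.1 a) := by
      have h0 : Recol.diag U.ι = recOf f.2 f.2 := by
        apply Recol.ext
        ext x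
        rw [mem_recOf, Recol.diag, mem_recOf]
        refine and_congr_right fun hne => ⟨?_, ?_⟩
        · rintro ⟨i, rfl⟩
          obtain ⟨b, hb⟩ := (f.2 i).exists
          exact ⟨b, by rw [hb]⟩
        · rintro ⟨b, rfl⟩
          cases hb : f.1 b with
          | none => rw [hb] at hne; exact absurd rfl hne
          | some i => exact ⟨i, rfl⟩
      rw [h0]; exact adapted_recOf _ _
    simp only [idH]
    rw [entry_single o had, ins_tprod]
    refine congrArg (PiTensorProduct.tprod k) (funext fun a => ?_)
    by_cases ha : (f.1 a, f.1 a) = (none, none)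
    · have : ∀ (i : Option U.ι) (hi : i = none)
        (φ : ∀ x : (Recol.diag U.ι).blocks, homE o U U x),
        hat k (E := homE o U U) (homE.e o U U) _ φ (i, i) = 𝟙 (U.ext o i) := by
        rintro i rfl φ
        exact hat_base _ (Recol.diag U.ι).none_notMem _
      exact this _ (congrArg Prod.fst ha) _
    · rw [hat_mem _ _ (had.mem a ha)]
      rfl
  · refine Eq.trans ?_ (Mat_.id_apply_of_ne (brMatObj o N U) f g hfg).symm
    simp only [idH]
    refine entry_single_ne o (fun h0 => hfg ?_) _
    have h1 : ∀ a, f.1 a = g.1 a := by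
      intro a
      by_cases ha : (f.1 a, g.1 a) = (none, none)
      · simp only [Prod.mk.injEq] at ha; rw [ha.1, ha.2]
      · have : (f.1 a, g.1 a) ∈ (Recol.diag U.ι).blocks := by
          rw [h0]; exact (mem_recOf _ _ _).2 ⟨ha, a, rfl⟩
        exact Recol.diag_eq ⟨_, this⟩
    exact Subtype.ext (funext h1)

lemma eq_of_brMat {Φ Φ' : HH o U V} (hN : ∀ r : Recol U.ι V.ι, r.card ≤ N)
    (h : brMat o N Φ = brMat o N Φ') : Φ = Φ' := by
  rw [← sub_eq_zero]
  refine eq_zero_of_entry o hN fun f g => ?_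
  rw [map_sub, sub_eq_zero]
  exact congrFun (congrFun h f) g

lemma exists_bound (I J : Type) [Fintype I] [Fintype J] :
    ∃ N₀, ∀ N, N₀ ≤ N → ∀ r : Recol I J, r.card ≤ N :=
  ⟨Finset.univ.sup Recol.card, fun _ hN r => (Finset.le_sup (Finset.mem_univ r)).trans hN⟩

lemma compH_add_left (t : k) (Φ Φ' : HH o U V) (Ψ : HH o V W) :
    compH o t (Φ + Φ') Ψ = compH o t Φ Ψ + compH o t Φ' Ψ := by
  simp only [compH, Pi.add_apply, map_add, LinearMap.add_apply, Pi.single_add, smul_add,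
    Finset.sum_add_distrib]

lemma compH_add_right (t : k) (Φ : HH o U V) (Ψ Ψ' : HH o V W) :
    compH o t Φ (Ψ + Ψ') = compH o t Φ Ψ + compH o t Φ Ψ' := by
  simp only [compH, Pi.add_apply, map_add, Pi.single_add, smul_add, Finset.sum_add_distrib]

lemma compH_smul_left (t c : k) (Φ : HH o U V) (Ψ : HH o V W) :
    compH o t (c • Φ) Ψ = c • compH o t Φ Ψ := by
  simp only [compH, Pi.smul_apply, map_smul, LinearMap.smul_apply, Pi.single_smul,
    Finset.smul_sum]
  exact Finset.sum_congr rfl fun u _ => smul_comm _ _ _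

lemma compH_smul_right (t c : k) (Φ : HH o U V) (Ψ : HH o V W) :
    compH o t Φ (c • Ψ) = c • compH o t Φ Ψ := by
  simp only [compH, Pi.smul_apply, map_smul, Pi.single_smul, Finset.smul_sum]
  exact Finset.sum_congr rfl fun u _ => smul_comm _ _ _

lemma isPoly_compH {F : ℕ → HH o U V} {G : ℕ → HH o V W} (hFG : (IsPoly F ∧ ∃ Ψ, G = fun _ => Ψ) ∨
    (IsPoly G ∧ ∃ Φ, F = fun _ => Φ)) : IsPoly fun N => compH o (N : k) (F N) (G N) := by
  classical
  refine IsPoly.sum _ fun u => ?_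
  refine IsPoly.prod_smul (k := k) _
    (F := fun N => Pi.single u.π₁₃ (compU o u (F N u.π₁₂) (G N u.π₂₃))) ?_
  rcases hFG with ⟨hF, Ψ, rfl⟩ | ⟨hG, Φ, rfl⟩
  · exact hF.map ((LinearMap.single k (fun r => Hr o U W r) u.π₁₃).comp
      (((compU o u).flip (Ψ u.π₂₃)).comp (LinearMap.proj u.π₁₂)))
  · exact hG.map ((LinearMap.single k (fun r => Hr o U W r) u.π₁₃).comp
      ((compU o u (Φ u.π₁₂)).comp (LinearMap.proj u.π₂₃)))

lemma IsPoly.eq_of_eventually {M : Type*} [AddCommGroup M] [Module k M] {F G : ℕ → M}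
    (hF : IsPoly F) (hG : IsPoly G) {N₀ : ℕ} (h : ∀ N, N₀ ≤ N → F N = G N) (N : ℕ) :
    F N = G N := by
  have h1 : IsPoly (F + fun N => (-1 : k) • G N) := hF.add (hG.map (LinearMap.lsmul k M (-1)))
  have := h1.eq_zero (N₀ := N₀) (fun N hN => by simp [h N hN]) N
  simpa [← sub_eq_add_neg, sub_eq_zero] using this

lemma compH_assoc (d : ℕ) (Φ : HH o U V) (Ψ : HH o V W) (Θ : HH o W X) :
    compH o (d : k) (compH o (d : k) Φ Ψ) Θ = compH o (d : k) Φ (compH o (d : k) Ψ Θ) := by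
  obtain ⟨N₀, hN₀⟩ := exists_bound U.ι X.ι
  have h1 : IsPoly fun N : ℕ => compH o (N : k) (compH o (N : k) Φ Ψ) Θ :=
    isPoly_compH o (G := fun _ => Θ)
      (.inl ⟨isPoly_compH o (F := fun _ => Φ) (G := fun _ => Ψ) (.inl ⟨IsPoly.const _, _, rfl⟩),
        _, rfl⟩)
  have h2 : IsPoly fun N : ℕ => compH o (N : k) Φ (compH o (N : k) Ψ Θ) :=
    isPoly_compH o (F := fun _ => Φ)
      (.inr ⟨isPoly_compH o (F := fun _ => Ψ) (G := fun _ => Θ) (.inl ⟨IsPoly.const _, _, rfl⟩),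
        _, rfl⟩)
  refine IsPoly.eq_of_eventually (k := k) h1 h2 (N₀ := N₀) (fun N hN => ?_) d
  refine eq_of_brMat o (hN₀ N hN) ?_
  simp only [brMat_comp, Category.assoc]

lemma compH_id_left (d : ℕ) (Φ : HH o U V) : compH o (d : k) (idH o U) Φ = Φ := by
  obtain ⟨N₀, hN₀⟩ := exists_bound U.ι V.ι
  have h1 : IsPoly fun N : ℕ => compH o (N : k) (idH o U) Φ :=
    isPoly_compH o (F := fun _ => idH o U) (G := fun _ => Φ) (.inl ⟨IsPoly.const _, _, rfl⟩)
  refine IsPoly.eq_of_eventually (k := k) h1 (IsPoly.const Φ) (N₀ := N₀) (fun N hN => ?_) d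
  refine eq_of_brMat o (hN₀ N hN) ?_
  rw [brMat_comp, brMat_id, Category.id_comp]

lemma compH_id_right (d : ℕ) (Φ : HH o U V) : compH o (d : k) Φ (idH o V) = Φ := by
  obtain ⟨N₀, hN₀⟩ := exists_bound U.ι V.ι
  have h1 : IsPoly fun N : ℕ => compH o (N : k) Φ (idH o V) :=
    isPoly_compH o (F := fun _ => Φ) (G := fun _ => idH o V) (.inl ⟨IsPoly.const _, _, rfl⟩)
  refine IsPoly.eq_of_eventually (k := k) h1 (IsPoly.const Φ) (N₀ := N₀) (fun N hN => ?_) d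
  refine eq_of_brMat o (hN₀ N hN) ?_
  rw [brMat_comp, brMat_id, Category.comp_id]

end Matrices

/-! ### Reindexing isomorphisms between formal direct sums -/

section MatPerm

variable {D : Type u} [Category.{v} D] [Preadditive D] {M N K : Mat_ D}

open scoped Classical in
/-- The morphism between formal direct sums which identifies the summands along a bijection. -/
def matPerm (e : M.ι ≃ N.ι) (h : ∀ i, M.X i = N.X (e i)) : M ⟶ N :=
  fun i j => if hij : e i = j then eqToHom ((h i).trans (congrArg N.X hij)) else 0

lemma matPerm_self (e : M.ι ≃ N.ι) (h : ∀ i, M.X i = N.X (e i)) (i : M.ι) :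
    matPerm e h i (e i) = eqToHom (h i) := by
  simp [matPerm]

lemma matPerm_ne (e : M.ι ≃ N.ι) (h : ∀ i, M.X i = N.X (e i)) {i : M.ι} {j : N.ι} (hij : e i ≠ j) :
    matPerm e h i j = 0 := by
  simp [matPerm, hij]

lemma matPerm_comp_apply (e : M.ι ≃ N.ι) (h : ∀ i, M.X i = N.X (e i)) (F : N ⟶ K) (i : M.ι)
    (j : K.ι) : (matPerm e h ≫ F) i j = eqToHom (h i) ≫ F (e i) j := by
  rw [Mat_.comp_apply, Finset.sum_eq_single (e i), matPerm_self]
  · intro l _ hl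
    rw [matPerm_ne e h hl.symm, Limits.zero_comp]
  · intro hi; exact absurd (Finset.mem_univ _) hi

lemma comp_matPerm_apply (e : M.ι ≃ N.ι) (h : ∀ i, M.X i = N.X (e i)) (F : K ⟶ M) (i : K.ι)
    (j : M.ι) : (F ≫ matPerm e h) i (e j) = F i j ≫ eqToHom (h j) := by
  rw [Mat_.comp_apply, Finset.sum_eq_single j, matPerm_self]
  · intro l _ hl
    rw [matPerm_ne e h (fun h' => hl (e.injective h')), Limits.comp_zero]
  · intro hi; exact absurd (Finset.mem_univ _) hi

lemma matPerm_comp (e : M.ι ≃ N.ι) (h : ∀ i, M.X i = N.X (e i)) (e' : N.ι ≃ K.ι)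
    (h' : ∀ i, N.X i = K.X (e' i)) :
    matPerm e h ≫ matPerm e' h' = matPerm (e.trans e') fun i => (h i).trans (h' (e i)) := by
  apply Mat_.hom_ext
  intro i j
  rw [matPerm_comp_apply]
  by_cases hij : e' (e i) = j
  · subst hij
    rw [matPerm_self]
    refine Eq.trans ?_ (matPerm_self (e.trans e') _ i).symm
    exact eqToHom_trans _ _
  · rw [matPerm_ne _ _ hij, Limits.comp_zero]
    exact (matPerm_ne (e.trans e') _ hij).symm

lemma matPerm_eq_id (e : M.ι ≃ M.ι) (h : ∀ i, M.X i = M.X (e i)) (he : e = Equiv.refl _) :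
    matPerm e h = 𝟙 M := by
  subst he
  apply Mat_.hom_ext
  intro i j
  by_cases hij : i = j
  · subst hij
    refine (matPerm_self (Equiv.refl _) h i).trans ?_
    rw [Mat_.id_apply_self]; rfl
  · rw [matPerm_ne _ _ hij, Mat_.id_apply_of_ne _ _ _ hij]

lemma matPerm_congr {e e' : M.ι ≃ N.ι} (he : e = e') (h : ∀ i, M.X i = N.X (e i))
    (h' : ∀ i, M.X i = N.X (e' i)) : matPerm e h = matPerm e' h' := by
  subst he; rfl

lemma mapMat_matPerm {D' : Type u} [Category.{v} D'] [Preadditive D'] (F : D ⥤ D') [F.Additive]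
    (e : M.ι ≃ N.ι) (h : ∀ i, M.X i = N.X (e i)) :
    F.mapMat_.map (matPerm e h) =
      matPerm (M := F.mapMat_.obj M) (N := F.mapMat_.obj N) e fun i => congrArg F.obj (h i) := by
  apply Mat_.hom_ext
  intro (i : M.ι) (j : N.ι)
  change F.map (matPerm e h i j) = _
  by_cases hij : e i = j
  · subst hij
    rw [matPerm_self, eqToHom_map]
    exact (matPerm_self (M := F.mapMat_.obj M) (N := F.mapMat_.obj N) e _ i).symm
  · rw [matPerm_ne e h hij, F.map_zero]
    exact (matPerm_ne (M := F.mapMat_.obj M) (N := F.mapMat_.obj N) e _ hij).symm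

end MatPerm

/-! ### The wreath product category -/

section Action

variable {k : Type w} [CommRing k] {G : Type} [Group G] {D : Type u} [Category.{v} D]
    [Preadditive D] [Linear k D]

/-- A strict action of a group on a `k`-linear category. -/
def CatAction.ofStrict (act : G → D ⥤ D) (hadd : ∀ g, (act g).Additive)
    (hlin : ∀ g, (act g).Linear k) (hmul : ∀ g h, act h ⋙ act g = act (g * h))
    (hone : 𝟭 D = act 1) : CatAction k G D where
  act := act
  additive := hadd
  linear := hlin
  mul g h := eqToIso (hmul g h)
  one := eqToIso hone
  assoc g h l U := by simp [eqToHom_app, eqToHom_map]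
  mul_one g U := by simp [eqToHom_app, eqToHom_map]
  one_mul g U := by simp [eqToHom_app]

lemma psMap_congr {D' : Type u} [Category.{v} D'] [Preadditive D'] {F G : D ⥤ D'} [F.Additive]
    [G.Additive] (h : F = G) : psMap F = psMap G := by
  subst h; rfl

lemma psMap_comp {D' D'' : Type u} [Category.{v} D'] [Preadditive D'] [Category.{v} D'']
    [Preadditive D''] (F : D ⥤ D') (G : D' ⥤ D'') [F.Additive] [G.Additive] :
    psMap F ⋙ psMap G = psMap (F ⋙ G) := rfl

lemma psMap_id : psMap (𝟭 D) = 𝟭 (Ps D) := rfl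

variable (k) (C : Type u) [Category.{v} C] [Preadditive C] [Linear k C] {d : ℕ}

lemma permTP_mul (g h : Equiv.Perm (Fin d)) :
    permTP k C h ⋙ permTP k C g = permTP k C (g * h) := by
  refine CategoryTheory.Functor.hext (fun _ => rfl) fun U V f => heq_of_eq ?_
  exact PiTensorProduct.reindex_reindex (R := k) (s := fun a => (U.obj a ⟶ V.obj a)) h g f

lemma permTP_one : 𝟭 (TP k C d) = permTP k C 1 := by
  refine CategoryTheory.Functor.hext (fun _ => rfl) fun U V f => heq_of_eq ?_
  exact (LinearEquiv.congr_fun (PiTensorProduct.reindex_refl (R := k)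
    (s := fun a => (U.obj a ⟶ V.obj a))) f).symm

variable (d)

/-- The action of the symmetric group on the `d`-th tensor power of `C`, made pseudo-abelian. -/
def permAction : CatAction k (Equiv.Perm (Fin d)) (Ps (TP k C d)) :=
  CatAction.ofStrict (fun g => psMap (permTP k C g)) (fun g => psMap_additive (permTP k C g))
    (fun g => psMap_linear k (permTP k C g))
    (fun g h => (psMap_comp (permTP k C h) (permTP k C g)).trans (psMap_congr (permTP_mul k C g h)))
    (psMap_id.symm.trans (psMap_congr (permTP_one k C)))

/-- The wreath product category: the invariants of the symmetric group in the `d`-th tensor power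
of `C`. -/
abbrev WCat := Inv (permAction k C d)

end Action


section Bracket

variable {k : Type w} [CommRing k] {C : Type u} [Category.{v} C] [Preadditive C] [Linear k C]
  (o : UnitObj k C) {U V W : Fam C} {d : ℕ}

/-- The permutation of the sequences by `(g · f)_a = f_{g⁻¹ a}`. -/
def permSeq {I : Type} (g : Equiv.Perm (Fin d)) : Seq d I ≃ Seq d I where
  toFun f := ⟨fun a => f.1 (g.symm a), fun i => by
    obtain ⟨a, ha, ha'⟩ := f.2 i
    exact ⟨g a, by simpa using ha, fun b hb => by rw [← ha' _ hb]; simp⟩⟩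
  invFun f := ⟨fun a => f.1 (g a), fun i => by
    obtain ⟨a, ha, ha'⟩ := f.2 i
    exact ⟨g.symm a, by simpa using ha, fun b hb => by rw [← ha' _ hb]; simp⟩⟩
  left_inv f := Subtype.ext (funext fun a => by simp)
  right_inv f := Subtype.ext (funext fun a => by simp)

lemma adapted_perm {X : Type} {x : X} {r : Finset X} {p : Fin d → X} (h : Adapted x r p)
    (g : Equiv.Perm (Fin d)) : Adapted x r fun a => p (g.symm a) where
  base_notMem := h.base_notMem
  mem b hb := h.mem _ hb
  unique y hy := by
    obtain ⟨a, ha, ha'⟩ := h.unique y hy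
    exact ⟨g a, by simpa using ha, fun b hb => by rw [← ha' _ hb]; simp⟩

/-- The entries of `[Φ]` are invariant under permutations. -/
lemma entry_perm (g : Equiv.Perm (Fin d)) (f : Seq d U.ι) (f' : Seq d V.ι) (Φ : HH o U V) :
    PiTensorProduct.reindex k (fun a => (U.ext o (f.1 a) ⟶ V.ext o (f'.1 a))) g (entry o f f' Φ) =
      entry o (permSeq g f) (permSeq g f') Φ := by
  have h1 := adapted_recOf f.2 f'.2
  have h2 : Adapted (none, none) (recOf f.2 f'.2).blocks
    fun a => ((permSeq g f).1 a, (permSeq g f').1 a) := adapted_perm h1 g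
  rw [entry_eq o h1, entry_eq o h2]
  generalize Φ (recOf f.2 f'.2) = x
  induction x using PiTensorProduct.induction_on with
  | add x y hx hy =>
    rw [map_add, map_add, hx, hy]
    exact (map_add (ins k (E := homE o U V) (homE.e o U V) h2) x y).symm
  | smul_tprod c φ =>
    simp only [map_smul]
    congr 1
    rw [ins_tprod, ins_tprod]
    exact PiTensorProduct.reindex_tprod g _

/-- The permutation matrix which identifies `g · U_{f}` with `U_{g · f}`. -/
def brPerm (U : Fam C) (g : Equiv.Perm (Fin d)) :
    (permTP k C g).mapMat_.obj (brMatObj o d U) ⟶ brMatObj o d U :=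
  matPerm (M := (permTP k C g).mapMat_.obj (brMatObj o d U)) (N := brMatObj o d U)
    (permSeq g) fun _ => rfl

/-- The inverse permutation matrix. -/
def brPermInv (U : Fam C) (g : Equiv.Perm (Fin d)) :
    brMatObj o d U ⟶ (permTP k C g).mapMat_.obj (brMatObj o d U) :=
  matPerm (M := brMatObj o d U) (N := (permTP k C g).mapMat_.obj (brMatObj o d U))
    (permSeq g).symm fun f => by
      conv_lhs => rw [← (permSeq g).apply_symm_apply f]
      rfl

lemma brPerm_inv (U : Fam C) (g : Equiv.Perm (Fin d)) :
    brPerm o U g ≫ brPermInv o U g = 𝟙 _ := by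
  refine (matPerm_comp _ _ _ _).trans (matPerm_eq_id _ _ (Equiv.self_trans_symm _))

lemma brPermInv_perm (U : Fam C) (g : Equiv.Perm (Fin d)) :
    brPermInv o U g ≫ brPerm o U g = 𝟙 _ := by
  refine (matPerm_comp _ _ _ _).trans (matPerm_eq_id _ _ (Equiv.symm_trans_self _))

lemma brPerm_mul (U : Fam C) (g h : Equiv.Perm (Fin d)) :
    (permTP k C g).mapMat_.map (brPerm o U h) ≫ brPerm o U g = brPerm o U (g * h) := by
  refine (congrArg (· ≫ brPerm o U g) (mapMat_matPerm (permTP k C g)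
    (M := (permTP k C h).mapMat_.obj (brMatObj o d U)) (N := brMatObj o d U)
    (permSeq h) fun _ => rfl)).trans ?_
  refine (matPerm_comp _ _ _ _).trans (matPerm_congr ?_ _ _)
  rfl

lemma brPerm_one (U : Fam C) : brPerm o U (1 : Equiv.Perm (Fin d)) = 𝟙 (brMatObj o d U) := by
  refine matPerm_eq_id (M := brMatObj o d U) _ _ rfl

lemma brPerm_brMat (g : Equiv.Perm (Fin d)) (Φ : HH o U V) :
    (permTP k C g).mapMat_.map (brMat o d Φ) ≫ brPerm o V g = brPerm o U g ≫ brMat o d Φ := by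
  apply Mat_.hom_ext
  intro (f : Seq d U.ι) (f' : Seq d V.ι)
  obtain ⟨f', rfl⟩ := (permSeq g).surjective f'
  have h1 := comp_matPerm_apply (M := (permTP k C g).mapMat_.obj (brMatObj o d V))
    (N := brMatObj o d V) (permSeq g) (fun _ => rfl)
    ((permTP k C g).mapMat_.map (brMat o d Φ)) f f'
  have h2 := matPerm_comp_apply (M := (permTP k C g).mapMat_.obj (brMatObj o d U))
    (N := brMatObj o d U) (permSeq g) (fun _ => rfl) (brMat o d Φ) f (permSeq g f')
  refine h1.trans (Eq.trans ?_ h2.symm)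
  refine (Category.comp_id _).trans (Eq.trans ?_ (Category.id_comp _).symm)
  exact entry_perm o g f f' Φ

lemma permAction_mul_f (M : Mat_ (TP k C d)) (g h : Equiv.Perm (Fin d)) :
    (((permAction k C d).mul g h).hom.app ((Idempotents.toKaroubi _).obj M)).f =
      𝟙 ((permTP k C g).mapMat_.obj ((permTP k C h).mapMat_.obj M)) := by
  have H : ((permAction k C d).act h ⋙ (permAction k C d).act g) = (permAction k C d).act (g * h) :=
    (psMap_comp (permTP k C h) (permTP k C g)).trans (psMap_congr (permTP_mul k C g h))
  refine (congrArg Idempotents.Karoubi.Hom.f (eqToHom_app H _)).trans ?_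
  refine (Idempotents.Karoubi.eqToHom_f _).trans ?_
  refine (Category.comp_id _).trans ?_
  change (permTP k C g).mapMat_.map ((permTP k C h).mapMat_.map (𝟙 M)) = _
  rw [CategoryTheory.Functor.map_id, CategoryTheory.Functor.map_id]

lemma permAction_one_f (M : Mat_ (TP k C d)) :
    ((permAction k C d).one.hom.app ((Idempotents.toKaroubi _).obj M)).f = 𝟙 M := by
  have H : 𝟭 _ = (permAction k C d).act 1 := psMap_id.symm.trans (psMap_congr (permTP_one k C))
  refine (congrArg Idempotents.Karoubi.Hom.f (eqToHom_app H _)).trans ?_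
  refine (Idempotents.Karoubi.eqToHom_f _).trans ?_
  exact Category.comp_id _

/-- The isomorphism `g · [U_I] ≅ [U_I]`. -/
def brκ (U : Fam C) (g : Equiv.Perm (Fin d)) :
    ((permAction k C d).act g).obj ((Idempotents.toKaroubi _).obj (brMatObj o d U)) ≅
      (Idempotents.toKaroubi _).obj (brMatObj o d U) where
  hom := ⟨brPerm o U g, by
    change (permTP k C g).mapMat_.map (𝟙 _) ≫ brPerm o U g ≫ 𝟙 _ = brPerm o U g
    rw [CategoryTheory.Functor.map_id, Category.id_comp, Category.comp_id]⟩
  inv := ⟨brPermInv o U g, by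
    change 𝟙 _ ≫ brPermInv o U g ≫ (permTP k C g).mapMat_.map (𝟙 _) = brPermInv o U g
    rw [CategoryTheory.Functor.map_id, Category.id_comp, Category.comp_id]⟩
  hom_inv_id := by
    apply Idempotents.Karoubi.hom_ext
    exact (brPerm_inv o U g).trans ((permTP k C g).mapMat_.map_id _).symm
  inv_hom_id := by
    apply Idempotents.Karoubi.hom_ext
    exact brPermInv_perm o U g

/-- The object `[U_I]` of the wreath product category, namely `⨁ U_{i₁} ⊠ ⋯ ⊠ U_{i_d}` with the
isomorphisms which permute the factors and the summands. -/
def brObj (d : ℕ) (U : Fam C) : WCat k C d where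
  obj := (Idempotents.toKaroubi _).obj (brMatObj o d U)
  κ g := brκ o U g
  mul g h := by
    apply Idempotents.Karoubi.hom_ext
    refine (brPerm_mul o U g h).trans ?_
    refine Eq.trans ?_ (congrArg (· ≫ brPerm o U (g * h))
      (permAction_mul_f (brMatObj o d U) g h)).symm
    exact (Category.id_comp _).symm
  one := by
    apply Idempotents.Karoubi.hom_ext
    refine (congrArg (· ≫ brPerm o U (1 : Equiv.Perm (Fin d)))
      (permAction_one_f (brMatObj o d U))).trans ?_
    exact (Category.id_comp _).trans (brPerm_one o U)

/-- The linear map `Φ ↦ [Φ]`. -/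
def brHom : HH o U V →ₗ[k] (brObj o d U ⟶ brObj o d V) where
  toFun Φ :=
    { hom := (Idempotents.toKaroubi _).map (brMat o d Φ)
      comm := fun g => by
        apply Idempotents.Karoubi.hom_ext
        exact brPerm_brMat o g Φ }
  map_add' Φ Φ' := by
    apply Inv.hom_ext
    apply Idempotents.Karoubi.hom_ext
    exact map_add (brMat o d) Φ Φ'
  map_smul' c Φ := by
    apply Inv.hom_ext
    apply Idempotents.Karoubi.hom_ext
    exact map_smul (brMat o d) c Φ

end Bracket

/-! ### The interpolating category in rank `d` -/

section Interpolation

variable {k : Type w} [CommRing k] {C : Type u} [Category.{v} C] [Preadditive C] [Linear k C]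

/-- The category with objects `⟨U_I⟩`, for finite families `U_I` of objects of `C`, morphisms
`H(U_I; V_J)` and the composition in rank `d`. -/
structure SPre (o : UnitObj k C) (d : ℕ) where
  fam : Fam C

variable (o : UnitObj k C) (d : ℕ)

instance : Category.{max w v} (SPre o d) where
  Hom U V := HH o U.fam V.fam
  id U := idH o U.fam
  comp Φ Ψ := compH o (d : k) Φ Ψ
  id_comp Φ := compH_id_left o d Φ
  comp_id Φ := compH_id_right o d Φ
  assoc Φ Ψ Θ := compH_assoc o d Φ Ψ Θ

instance SPre.homGroup (U V : SPre o d) : AddCommGroup (U ⟶ V) :=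
  inferInstanceAs (AddCommGroup (HH o U.fam V.fam))

instance SPre.homModule (U V : SPre o d) : Module k (U ⟶ V) :=
  inferInstanceAs (Module k (HH o U.fam V.fam))

instance : Preadditive (SPre o d) where
  homGroup U V := SPre.homGroup o d U V
  add_comp _ _ _ Φ Φ' Ψ := compH_add_left o (d : k) Φ Φ' Ψ
  comp_add _ _ _ Φ Ψ Ψ' := compH_add_right o (d : k) Φ Ψ Ψ'

instance : Linear k (SPre o d) where
  homModule U V := SPre.homModule o d U V
  smul_comp _ _ _ c Φ Ψ := compH_smul_left o (d : k) c Φ Ψ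
  comp_smul _ _ _ Φ c Ψ := compH_smul_right o (d : k) c Φ Ψ

/-- The category `S_d(C)`, the pseudo-abelian envelope of the category of the objects `⟨U_I⟩`. -/
abbrev SCat := Ps (SPre o d)

/-- The object `⟨U_I⟩` of `S_d(C)`. -/
def agObj (U : Fam C) : SCat o d := (toPs (SPre o d)).obj ⟨U⟩

variable {U V : Fam C}

/-- The identification `Φ ↦ ⟨Φ⟩` of `H(U; V)` with the morphisms `⟨U⟩ → ⟨V⟩` of `S_d(C)`. -/
def ag : HH o U V ≃ₗ[k] (agObj o d U ⟶ agObj o d V) where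
  toFun Φ := (toPs (SPre o d)).map (X := ⟨U⟩) (Y := ⟨V⟩) Φ
  invFun f := f.f PUnit.unit PUnit.unit
  map_add' Φ Φ' := by
    apply Idempotents.Karoubi.hom_ext
    apply Mat_.hom_ext
    intro i j
    rfl
  map_smul' c Φ := by
    apply Idempotents.Karoubi.hom_ext
    apply Mat_.hom_ext
    intro i j
    rfl
  left_inv Φ := rfl
  right_inv f := by
    apply Idempotents.Karoubi.hom_ext
    apply Mat_.hom_ext
    intro i j
    rfl

/-- The linear map `⟨Φ⟩ ↦ [Φ]` from the morphisms of `S_d(C)` to the morphisms of the wreath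
product category. -/
def agToBr (U V : Fam C) : (agObj o d U ⟶ agObj o d V) →ₗ[k] (brObj o d U ⟶ brObj o d V) :=
  (brHom o).comp (ag o d).symm.toLinearMap

end Interpolation

end Wreath

end

/-!
The entry of `[Φ]` at a cell `(f, f')` is the component `Φ_r`, for the recollement `r` which `f` and
`f'` induce, with identities of `𝟏` inserted. Insertion is bijective because `End(𝟏) = k`
(`con_ins`, `ins_con`), and the recollements induced by cells are exactly those with at most `d`
classes. Hence `[Φ] = 0` means that `Φ` lies in `H^{>d}` (`brMat_eq_zero_iff`). The symmetric group
acts transitively on the cells inducing a given recollement (`exists_permSeq`), so an invariant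
matrix is determined by one entry for each `r`, which may be prescribed freely; this is
surjectivity (`exists_brMat_eq`). A recollement of `I` and `J` has at most `#I + #J` classes, whence
the bijectivity for `#I + #J ≤ d`.

Direct sums and images of idempotents of invariant objects are invariant objects (`Inv.ofSum`), so
that the wreath product category is pseudo-abelian. The functor `⟨Φ⟩ ↦ [Φ]` therefore extends to the
pseudo-abelian envelope (`psLift`).

For essential surjectivity, an invariant object `X` is a direct factor of a sum of objects
`U₁ ⊠ ⋯ ⊠ U_d` of the tensor power, and `U₁ ⊠ ⋯ ⊠ U_d` is a summand of `[U]` whose translates under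
the symmetric group are orthogonal. Averaging the inclusion and the projection over the symmetric
group gives invariant morphisms whose composite on `X` is `d!` (`Inv.sum_avg_comp_avg`), so `X` is
a direct factor of a sum of objects `[U]` (`exists_retract`). The corresponding idempotent lifts:
between families of exactly `d` objects, the recollements with at most `d` classes are bijections,
so that they span a submodule closed under composition and complementary to the kernel
(`compH_mem_HHle`, `exists_idempotent_lift`).
-/

noncomputable section
namespace Wreath

/-! ### Contraction and insertion -/

section Tensor
open PiTensorProduct

variable {k : Type w} [CommRing k] {X B : Type} {o : X}
  {E : X → Type v} [∀ x, AddCommGroup (E x)] [∀ x, Module k (E x)]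

/-- When `E o` is free of rank one on `e`, contraction is also a right inverse of insertion, so
that a tensor along an adapted family is the same as a tensor over `r`. -/
lemma ins_con [Fintype B] (e : E o) (sc : E o →ₗ[k] k) (hsc : ∀ a, sc a • e = a)
    {r : Finset X} {p : B → X} (hp : Adapted o r p) (Θ : ⨂[k] b, E (p b)) :
    ins k e hp (con k sc hp Θ) = Θ := by
  classical
  suffices h : (ins k e hp).comp (con k sc hp) = LinearMap.id from LinearMap.congr_fun h Θ
  refine PiTensorProduct.ext (MultilinearMap.ext fun θ => ?_)
  simp only [LinearMap.compMultilinearMap_apply, LinearMap.comp_apply, LinearMap.id_apply]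
  rw [con_tprod, map_smul, ins_tprod]
  have h1 : θ = fun b => scAt sc (p b) (θ b) •
      hat k e r (fun x : r => castE k E (hp.p_pos x) (θ (hp.pos x))) (p b) := by
    funext b
    by_cases hb : p b = o
    · simp only [scAt, hb, dif_pos]
      have : ∀ (x : X) (hx : x = o) (a : E x) (φ : ∀ x : r, E x),
          a = sc (castE k E hx a) • hat k e r φ x := by
        rintro x rfl a φ
        rw [hat_base _ hp.base_notMem, castE_rfl, hsc]
      exact this _ hb _ _
    · have hmem : p b ∈ r := hp.mem b hb
      rw [hat_mem _ _ hmem]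
      simp only [scAt, hb, dif_neg, not_false_eq_true, one_smul]
      exact (castE_comp (k := k) (π := p) θ (hp.pos_eq ⟨p b, hmem⟩ rfl)
        (hp.p_pos ⟨p b, hmem⟩) rfl).symm
  conv_rhs => rw [h1, MultilinearMap.map_smul_univ]

end Tensor

/-! ### Entries of invariant matrices -/

section Entries

/-- Two families adapted to the same finite set differ by a permutation. -/
lemma Adapted.exists_perm {B X : Type} [Fintype B] {o : X} {r : Finset X} {p q : B → X}
    (hp : Adapted o r p) (hq : Adapted o r q) : ∃ σ : Equiv.Perm B, ∀ b, q (σ b) = p b := by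
  classical
  let E : ∀ {p : B → X}, Adapted o r p → ({b // p b ≠ o} ≃ r) := fun {p} hp =>
    { toFun := fun b => ⟨p b, hp.mem b b.2⟩
      invFun := fun x => ⟨hp.pos x, by
        rw [hp.p_pos]; intro h; exact hp.base_notMem (h ▸ x.2)⟩
      left_inv := fun b => Subtype.ext (hp.pos_eq _ rfl)
      right_inv := fun x => Subtype.ext (hp.p_pos x) }
  let e := (E hp).trans (E hq).symm
  refine ⟨e.extendSubtype, fun b => ?_⟩
  by_cases hb : p b = o
  · have := e.extendSubtype_not_mem b (not_not.2 hb)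
    rw [hb, not_not.1 this]
  · rw [e.extendSubtype_apply_of_mem b hb]
    exact hq.p_pos ⟨p b, hp.mem b hb⟩

variable {I J : Type} {N : ℕ}

lemma card_recOf_le {f : Fin N → Option I} {g : Fin N → Option J} (hf : IsSeq f) (hg : IsSeq g) :
    (recOf hf hg).card ≤ N := by
  classical
  rw [Recol.card, ← (adapted_recOf hf hg).card_eq]
  exact (Finset.card_filter_le _ _).trans (by simp)

/-- The symmetric group acts transitively on the pairs of sequences which induce a given
recollement. -/
lemma exists_permSeq {f f' : Seq N I} {g g' : Seq N J} {r : Recol I J}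
    (h : Adapted (none, none) r.blocks fun a => (f.1 a, g.1 a))
    (h' : Adapted (none, none) r.blocks fun a => (f'.1 a, g'.1 a)) :
    ∃ σ : Equiv.Perm (Fin N), permSeq σ f = f' ∧ permSeq σ g = g' := by
  obtain ⟨σ, hσ⟩ := h.exists_perm h'
  have key : ∀ a, (f'.1 a, g'.1 a) = (f.1 (σ.symm a), g.1 (σ.symm a)) := fun a => by
    rw [← hσ, σ.apply_symm_apply]
  exact ⟨σ, Subtype.ext (funext fun a => (congrArg Prod.fst (key a)).symm),
    Subtype.ext (funext fun a => (congrArg Prod.snd (key a)).symm)⟩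

lemma Recol.card_le_add [Fintype I] [Fintype J] (r : Recol I J) :
    r.card ≤ Fintype.card I + Fintype.card J := by
  classical
  rw [← Fintype.card_sum, Recol.card, ← Fintype.card_coe]
  choose F hF hF' using r.fst
  choose G hG hG' using r.snd
  refine Fintype.card_le_of_surjective (Sum.elim F G) ?_
  rintro ⟨⟨_ | i, _ | j⟩, hx⟩
  · exact absurd hx r.none_notMem
  · exact ⟨.inr j, (hG' j _ rfl).symm⟩
  · exact ⟨.inl i, (hF' i _ rfl).symm⟩
  · exact ⟨.inl i, (hF' i _ rfl).symm⟩

variable {k : Type w} [CommRing k] {C : Type u} [Category.{v} C] [Preadditive C] [Linear k C]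
  (o : UnitObj k C) {U V W : Fam C} {d : ℕ}

/-- The submodule of `H(U; V)` spanned by the recollements with at most `d` classes. It is a
complement of `HHgt`. -/
def HHle (U V : Fam C) (d : ℕ) : Submodule k (HH o U V) where
  carrier := {Φ | ∀ r : Recol U.ι V.ι, d < r.card → Φ r = 0}
  add_mem' ha hb r hr := by simp [ha r hr, hb r hr]
  zero_mem' r _ := rfl
  smul_mem' c a ha r hr := by simp [ha r hr]

lemma brMat_eq_zero_iff (Φ : HH o U V) : brMat o d Φ = 0 ↔ Φ ∈ HHgt o U V d := by
  constructor
  · intro h r hr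
    obtain ⟨f, g, hfg⟩ := exists_recOf r hr
    have h1 : entry o f g Φ = 0 := congrFun (congrFun h f) g
    rw [entry_eq o hfg] at h1
    rw [← con_ins (E := homE o U V) (homE.e o U V) (homE.sc o U V) (homE.sc_e o U V) hfg (Φ r),
      h1, map_zero]
  · intro h
    apply Mat_.hom_ext
    intro (f : Seq d U.ι) (g : Seq d V.ι)
    change ins k (E := homE o U V) (homE.e o U V) (adapted_recOf f.2 g.2) (Φ _) = 0
    rw [h _ (card_recOf_le f.2 g.2)]
    exact map_zero (ins k (E := homE o U V) (homE.e o U V) (adapted_recOf f.2 g.2))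

/-- Every invariant matrix is of the form `[Φ]`: the entries at the cells inducing the recollement
`r` form a single orbit, so that they are determined by any one of them, and this one is the
insertion of an element of `H_r(U; V)`. -/
lemma exists_brMat_eq (F : brMatObj o d U ⟶ brMatObj o d V)
    (hF : ∀ g : Equiv.Perm (Fin d),
      (permTP k C g).mapMat_.map F ≫ brPerm o V g = brPerm o U g ≫ F) :
    ∃ Φ ∈ HHle o U V d, brMat o d Φ = F := by
  classical
  have hF' : ∀ (σ : Equiv.Perm (Fin d)) (f : Seq d U.ι) (g : Seq d V.ι),
      PiTensorProduct.reindex k (fun a => (U.ext o (f.1 a) ⟶ V.ext o (g.1 a))) σ (F f g) =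
        F (permSeq σ f) (permSeq σ g) := by
    intro σ f g
    have h1 := comp_matPerm_apply (M := (permTP k C σ).mapMat_.obj (brMatObj o d V))
      (N := brMatObj o d V) (permSeq σ) (fun _ => rfl)
      ((permTP k C σ).mapMat_.map F) f g
    have h2 := matPerm_comp_apply (M := (permTP k C σ).mapMat_.obj (brMatObj o d U))
      (N := brMatObj o d U) (permSeq σ) (fun _ => rfl) F f (permSeq σ g)
    have h3 := congrFun (congrFun (hF σ) f) (permSeq σ g)
    exact ((h1.trans (Category.comp_id _)).symm.trans h3).trans (h2.trans (Category.id_comp _))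
  -- One cell for each recollement with at most `d` classes; the other recollements have no cell.
  choose f g hfg using fun (r : Recol U.ι V.ι) (hr : r.card ≤ d) => exists_recOf r hr
  let Φ : HH o U V := fun r => if hr : r.card ≤ d then
    con k (E := homE o U V) (homE.sc o U V) (hfg r hr) (F (f r hr) (g r hr)) else 0
  refine ⟨Φ, fun r hr => dif_neg (not_le.2 hr), Mat_.hom_ext _ _ ?_⟩
  intro (f' : Seq d U.ι) (g' : Seq d V.ι)
  have hr := card_recOf_le f'.2 g'.2
  obtain ⟨σ, hσ, hσ'⟩ := exists_permSeq (hfg _ hr) (adapted_recOf f'.2 g'.2)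
  have h0 : entry o (f _ hr) (g _ hr) Φ = F (f _ hr) (g _ hr) := by
    rw [entry_eq o (hfg _ hr)]
    have h1 : Φ (recOf f'.2 g'.2) = con k (E := homE o U V) (homE.sc o U V) (hfg _ hr)
      (F (f _ hr) (g _ hr)) := dif_pos hr
    rw [h1]
    exact ins_con (E := homE o U V) (homE.e o U V) (homE.sc o U V) (homE.sc_smul o U V) _ _
  have h1 := entry_perm o σ (f _ hr) (g _ hr) Φ
  have h2 := hF' σ (f _ hr) (g _ hr)
  rw [h0, h2] at h1
  have key : ∀ (f₁ : Seq d U.ι) (g₁ : Seq d V.ι), permSeq σ (f _ hr) = f₁ →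
      permSeq σ (g _ hr) = g₁ → entry o f₁ g₁ Φ = F f₁ g₁ := by
    rintro _ _ rfl rfl
    exact h1.symm
  exact key f' g' hσ hσ'

lemma brHom_eq_zero_iff (Φ : HH o U V) :
    brHom o (d := d) Φ = 0 ↔ Φ ∈ HHgt o U V d := by
  rw [← brMat_eq_zero_iff]
  constructor
  · intro h
    exact congrArg (fun f => Idempotents.Karoubi.Hom.f (Inv.Hom.hom f)) h
  · intro h
    apply Inv.hom_ext
    apply Idempotents.Karoubi.hom_ext
    exact h

lemma exists_brHom_eq (F : brObj o d U ⟶ brObj o d V) : ∃ Φ ∈ HHle o U V d, brHom o Φ = F := by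
  obtain ⟨Φ, h, h'⟩ := exists_brMat_eq o F.hom.f fun g =>
    congrArg Idempotents.Karoubi.Hom.f (F.comm g)
  refine ⟨Φ, h, ?_⟩
  apply Inv.hom_ext
  apply Idempotents.Karoubi.hom_ext
  exact h'

lemma HHle_inf_HHgt {Φ : HH o U V} (h : Φ ∈ HHle o U V d) (h' : Φ ∈ HHgt o U V d) : Φ = 0 :=
  funext fun r => (le_or_gt r.card d).elim (h' r) (h r)

lemma HHgt_eq_bot (h : Fintype.card U.ι + Fintype.card V.ι ≤ d) : HHgt o U V d = ⊥ :=
  (Submodule.eq_bot_iff _).2 fun _ hΦ => funext fun r => hΦ r (r.card_le_add.trans h)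

/-- A sequence no longer than the number of elements it lists never takes the value `∅`. -/
lemma IsSeq.ne_none {B I : Type} [Fintype B] [Fintype I] {f : B → Option I} (hf : IsSeq f)
    (h : Fintype.card B ≤ Fintype.card I) (b : B) : f b ≠ none := by
  choose F hF _ using hf
  have hinj : Function.Injective F := fun i i' hi =>
    Option.some_injective _ ((hF i).symm.trans ((congrArg f hi).trans (hF i')))
  have hbij := (Fintype.bijective_iff_injective_and_card F).2 ⟨hinj,
    le_antisymm (Fintype.card_le_of_injective F hinj) h⟩
  obtain ⟨i, rfl⟩ := hbij.2 b
  rw [show f (F i) = some i from hF i]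
  exact Option.some_ne_none i

lemma Recol₃.card_π₁₃_le {I J K : Type} (u : Recol₃ I J K) : u.π₁₃.card ≤ u.card := by
  classical
  rw [Recol.card, ← u.adapted₁₃.card_eq]
  exact (Finset.card_filter_le _ _).trans (by simp [Recol₃.card])

/-- For a middle family of `d` objects, the recollements with at most `d` classes are stable under
composition: gluing two such recollements along `J` produces no class which avoids `J`. -/
lemma compH_mem_HHle (t : k) (hV : Fintype.card V.ι = d) {Φ : HH o U V} {Ψ : HH o V W}
    (hΦ : Φ ∈ HHle o U V d) (hΨ : Ψ ∈ HHle o V W d) : compH o t Φ Ψ ∈ HHle o U W d := by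
  classical
  refine Submodule.sum_mem _ fun u _ => Submodule.smul_mem _ _ ?_
  by_cases h1 : d < u.π₁₂.card
  · rw [hΦ _ h1, map_zero, LinearMap.zero_apply, Pi.single_zero]
    exact Submodule.zero_mem _
  by_cases h2 : d < u.π₂₃.card
  · rw [hΨ _ h2, map_zero, Pi.single_zero]
    exact Submodule.zero_mem _
  -- A class of `u` avoiding `J` would restrict to a class avoiding `J` of `π₁₂ u` or `π₂₃ u`, which
  -- have at most `#J` classes.
  have hu : ∀ y : u.blocks, ∃ j, y.1.2.1 = some j := by
    rintro ⟨⟨i, j, l⟩, hy⟩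
    refine Option.ne_none_iff_exists'.1 fun hj => ?_
    dsimp only at hj
    subst hj
    rcases i with _ | i
    · rcases l with _ | l
      · exact u.none_notMem hy
      · have hm : (none, some l) ∈ u.π₂₃.blocks := u.adapted₂₃.mem ⟨_, hy⟩ (by simp)
        exact IsSeq.ne_none u.π₂₃.fst (by rw [Fintype.card_coe, hV]; exact not_lt.1 h2) ⟨_, hm⟩ rfl
    · have hm : (some i, none) ∈ u.π₁₂.blocks := u.adapted₁₂.mem ⟨_, hy⟩ (by simp)
      exact IsSeq.ne_none u.π₁₂.snd (by rw [Fintype.card_coe, hV]; exact not_lt.1 h1) ⟨_, hm⟩ rfl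
  have hcard : u.card ≤ d := by
    choose j hj using hu
    rw [← hV, Recol₃.card, ← Fintype.card_coe]
    refine Fintype.card_le_of_injective j fun y y' h => ?_
    exact (u.snd (j y)).unique (hj y) (by rw [h, hj y'])
  intro r hr
  exact Pi.single_eq_of_ne (by rintro rfl; exact absurd (u.card_π₁₃_le) (by omega)) _

end Entries

/-! ### Direct sums, direct factors and averages of invariant objects -/

section Invariants

variable {k : Type w} [CommRing k] {G : Type} [Group G] {D : Type u} [Category.{v} D]
    [Preadditive D] [Linear k D] {A : CatAction k G D}

/-- The underlying morphism, as an additive map. -/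
def Inv.homAddHom (X Y : Inv A) : (X ⟶ Y) →+ (X.obj ⟶ Y.obj) where
  toFun f := f.hom
  map_zero' := rfl
  map_add' _ _ := rfl

lemma Inv.sum_hom {X Y : Inv A} {J : Type*} (s : Finset J) (f : J → (X ⟶ Y)) :
    (∑ j ∈ s, f j).hom = ∑ j ∈ s, (f j).hom :=
  map_sum (Inv.homAddHom X Y) f s

variable {J : Type} [Fintype J] {X : J → Inv A} {Y : D} {p : ∀ j, Y ⟶ (X j).obj}
  {i : ∀ j, (X j).obj ⟶ Y}

/-- The invariant structure on an object `Y` which is a direct factor of a finite direct sum of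
invariant objects `X j`, provided that the resulting morphisms between the `X j` are invariant.
Both direct sums and images of idempotents arise in this way. -/
def Inv.ofSum (htot : ∑ j, p j ≫ i j = 𝟙 Y)
    (hinv : ∀ (j l : J) (g : G),
      (A.act g).map (i j ≫ p l) ≫ ((X l).κ g).hom = ((X j).κ g).hom ≫ i j ≫ p l) : Inv A where
  obj := Y
  κ g :=
    { hom := ∑ j, (A.act g).map (p j) ≫ ((X j).κ g).hom ≫ i j
      inv := ∑ j, p j ≫ ((X j).κ g).inv ≫ (A.act g).map (i j)
      hom_inv_id := by
        have := A.additive g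
        have h : ∀ j l, ((A.act g).map (p j) ≫ ((X j).κ g).hom ≫ i j) ≫
            (p l ≫ ((X l).κ g).inv ≫ (A.act g).map (i l)) =
            (A.act g).map ((p j ≫ i j) ≫ (p l ≫ i l)) := by
          intro j l
          have h1 := hinv j l g
          simp only [Category.assoc, Functor.map_comp] at h1 ⊢
          rw [← reassoc_of% h1, Iso.hom_inv_id_assoc]
        simp only [Preadditive.sum_comp, Preadditive.comp_sum, h]
        simp only [← Functor.map_sum, ← Preadditive.comp_sum, ← Preadditive.sum_comp]
        rw [htot, Category.comp_id, CategoryTheory.Functor.map_id]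
      inv_hom_id := by
        have := A.additive g
        have h : ∀ j l, (p j ≫ ((X j).κ g).inv ≫ (A.act g).map (i j)) ≫
            ((A.act g).map (p l) ≫ ((X l).κ g).hom ≫ i l) = (p j ≫ i j) ≫ (p l ≫ i l) := by
          intro j l
          have h1 := hinv j l g
          simp only [Category.assoc, Functor.map_comp] at h1 ⊢
          rw [reassoc_of% h1, Iso.inv_hom_id_assoc]
        simp only [Preadditive.sum_comp, Preadditive.comp_sum, h]
        simp only [← Preadditive.comp_sum, ← Preadditive.sum_comp]
        rw [htot, Category.comp_id] }
  mul g h := by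
    have := A.additive g
    have h1 : ∀ j l, (A.act g).map ((A.act h).map (p j) ≫ ((X j).κ h).hom ≫ i j) ≫
        (A.act g).map (p l) ≫ ((X l).κ g).hom ≫ i l =
        (A.mul g h).hom.app Y ≫ (A.act (g * h)).map (p j) ≫ ((X j).κ (g * h)).hom ≫
          i j ≫ p l ≫ i l := by
      intro j l
      have h1 := hinv j l g
      have h2 := (X j).mul g h
      have h3 := (A.mul g h).hom.naturality (p j)
      simp only [Category.assoc, Functor.map_comp, Functor.comp_map] at h1 h2 h3 ⊢
      rw [reassoc_of% h1, reassoc_of% h2, reassoc_of% h3]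
    simp only [Functor.map_sum, Preadditive.sum_comp, Preadditive.comp_sum, h1]
    rw [Finset.sum_comm]
    simp only [← Preadditive.comp_sum, htot, Category.comp_id]
  one := by
    have h1 : ∀ j, A.one.hom.app Y ≫ (A.act 1).map (p j) ≫ ((X j).κ 1).hom ≫ i j = p j ≫ i j := by
      intro j
      have h2 := (X j).one
      have h3 := A.one.hom.naturality (p j)
      simp only [Functor.id_map] at h3
      rw [← reassoc_of% h3, reassoc_of% h2]
    simp only [Preadditive.comp_sum, h1, htot]

variable (htot : ∑ j, p j ≫ i j = 𝟙 Y)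
  (hinv : ∀ (j l : J) (g : G),
      (A.act g).map (i j ≫ p l) ≫ ((X l).κ g).hom = ((X j).κ g).hom ≫ i j ≫ p l)

/-- The invariant morphism from the direct factor to a summand. -/
def Inv.ofSumProj (l : J) : Inv.ofSum htot hinv ⟶ X l where
  hom := p l
  comm g := by
    have := A.additive g
    have h1 : ∀ j, ((A.act g).map (p j) ≫ ((X j).κ g).hom ≫ i j) ≫ p l =
        (A.act g).map ((p j ≫ i j) ≫ p l) ≫ ((X l).κ g).hom := by
      intro j
      have h1 := hinv j l g
      simp only [Category.assoc, Functor.map_comp] at h1 ⊢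
      rw [h1]
    change (A.act g).map (p l) ≫ ((X l).κ g).hom =
      (∑ j, (A.act g).map (p j) ≫ ((X j).κ g).hom ≫ i j) ≫ p l
    simp only [Preadditive.sum_comp, h1]
    simp only [← Preadditive.sum_comp, ← Functor.map_sum, htot, Category.id_comp]

/-- The invariant morphism from a summand to the direct factor. -/
def Inv.ofSumIncl (j : J) : X j ⟶ Inv.ofSum htot hinv where
  hom := i j
  comm g := by
    have h1 : ∀ l, (A.act g).map (i j) ≫ ((A.act g).map (p l) ≫ ((X l).κ g).hom ≫ i l) =
        ((X j).κ g).hom ≫ i j ≫ p l ≫ i l := by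
      intro l
      have h1 := hinv j l g
      simp only [Category.assoc, Functor.map_comp] at h1 ⊢
      rw [reassoc_of% h1]
    change (A.act g).map (i j) ≫ (∑ l, (A.act g).map (p l) ≫ ((X l).κ g).hom ≫ i l) =
      ((X j).κ g).hom ≫ i j
    simp only [Preadditive.comp_sum, h1]
    simp only [← Preadditive.comp_sum, htot, Category.comp_id]

open Limits in
lemma Inv.hasFiniteBiproducts [HasFiniteBiproducts D] : HasFiniteBiproducts (Inv A) := by
  classical
  refine ⟨fun n => ⟨fun X => ?_⟩⟩
  have htot : ∑ j, biproduct.π (fun j => (X j).obj) j ≫ biproduct.ι (fun j => (X j).obj) j =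
    𝟙 (⨁ fun j => (X j).obj) := biproduct.total
  have hinv : ∀ (j l : Fin n) (g : G),
      (A.act g).map (biproduct.ι (fun j => (X j).obj) j ≫ biproduct.π (fun j => (X j).obj) l) ≫
        ((X l).κ g).hom =
      ((X j).κ g).hom ≫ biproduct.ι (fun j => (X j).obj) j ≫
        biproduct.π (fun j => (X j).obj) l := by
    intro j l g
    have := A.additive g
    by_cases h : j = l
    · subst h
      simp
    · rw [biproduct.ι_π_ne _ h]
      simp
  refine hasBiproduct_of_total
    { pt := Inv.ofSum htot hinv
      π := Inv.ofSumProj htot hinv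
      ι := Inv.ofSumIncl htot hinv
      ι_π := fun j l => ?_ } ?_
  · apply Inv.hom_ext
    refine (biproduct.ι_π (fun j => (X j).obj) j l).trans ?_
    split_ifs with h
    · subst h
      rfl
    · rfl
  · apply Inv.hom_ext
    rw [Inv.sum_hom]
    exact htot

lemma Inv.isIdempotentComplete [IsIdempotentComplete D] : IsIdempotentComplete (Inv A) := by
  refine ⟨fun X e he => ?_⟩
  obtain ⟨Y, i, p, hip, hpi⟩ := IsIdempotentComplete.idempotents_split X.obj e.hom
    (congrArg Inv.Hom.hom he)
  have htot : ∑ _j : Unit, i ≫ p = 𝟙 Y := by simpa using hip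
  have hinv : ∀ (j l : Unit) (g : G),
      (A.act g).map (p ≫ i) ≫ (X.κ g).hom = (X.κ g).hom ≫ p ≫ i := by
    intro _ _ g
    rw [hpi]
    exact e.comm g
  refine ⟨Inv.ofSum (X := fun _ => X) htot hinv, Inv.ofSumProj (X := fun _ => X) htot hinv (),
    Inv.ofSumIncl (X := fun _ => X) htot hinv (), ?_, ?_⟩
  · exact Inv.hom_ext hip
  · exact Inv.hom_ext hpi

section Average

variable {P Q R : Inv A}

/-- The conjugate of a morphism by an element of the group. -/
def Inv.conj (g : G) (φ : P.obj ⟶ Q.obj) : P.obj ⟶ Q.obj :=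
  (P.κ g).inv ≫ (A.act g).map φ ≫ (Q.κ g).hom

lemma Inv.conj_conj (g h : G) (φ : P.obj ⟶ Q.obj) :
    Inv.conj g (Inv.conj h φ) = Inv.conj (g * h) φ := by
  have h1 := P.mul g h
  have h2 := Q.mul g h
  have h3 := (A.mul g h).hom.naturality φ
  simp only [Functor.comp_map] at h3
  unfold Inv.conj
  simp only [Functor.map_comp, Category.assoc, h2, reassoc_of% h3]
  have h4 : (P.κ (g * h)).hom ≫ (P.κ g).inv ≫ (A.act g).map (P.κ h).inv ≫
      (A.mul g h).hom.app P.obj = 𝟙 _ := by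
    rw [← cancel_epi ((A.mul g h).hom.app P.obj), ← reassoc_of% h1, Iso.hom_inv_id_assoc,
      ← Functor.map_comp_assoc, Iso.hom_inv_id, CategoryTheory.Functor.map_id, Category.id_comp,
      Category.comp_id]
  rw [← cancel_epi (P.κ (g * h)).hom, Iso.hom_inv_id_assoc, reassoc_of% h4]

lemma Inv.conj_one (φ : P.obj ⟶ Q.obj) : Inv.conj 1 φ = φ := by
  have h1 := A.one.hom.naturality φ
  simp only [Functor.id_map] at h1
  unfold Inv.conj
  rw [Iso.inv_comp_eq, ← cancel_epi (A.one.hom.app P.obj), ← reassoc_of% h1, Q.one,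
    ← Category.assoc, P.one]
  simp

lemma Inv.conj_hom (g : G) (f : P ⟶ Q) : Inv.conj g f.hom = f.hom := by
  rw [Inv.conj, f.comm, Iso.inv_hom_id_assoc]

lemma Inv.conj_comp (g : G) (φ : P.obj ⟶ Q.obj) (ψ : Q.obj ⟶ R.obj) :
    Inv.conj g (φ ≫ ψ) = Inv.conj g φ ≫ Inv.conj (P := Q) (Q := R) g ψ := by
  simp [Inv.conj]

/-- Orthogonality to a conjugate can be checked after removing outer factors. -/
lemma Inv.comp_conj_eq_zero {L N : D} (α : L ⟶ N) {a : N ⟶ P.obj} {N' : D} {b : P.obj ⟶ N'}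
    (β : N' ⟶ Q.obj) {g : G} (h : a ≫ (P.κ g).inv ≫ (A.act g).map b = 0) :
    (α ≫ a) ≫ Inv.conj (P := P) g (b ≫ β) = 0 := by
  simp only [Inv.conj, Functor.map_comp, Category.assoc]
  rw [reassoc_of% h]
  simp

lemma Inv.comm_of_conj {φ : P.obj ⟶ Q.obj} {g : G} (h : Inv.conj g φ = φ) :
    (A.act g).map φ ≫ (Q.κ g).hom = (P.κ g).hom ≫ φ := by
  rw [← Iso.inv_comp_eq]
  exact h

variable [Fintype G]

/-- The sum of the conjugates of a morphism under a finite group. -/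
def Inv.avg (φ : P.obj ⟶ Q.obj) : P ⟶ Q where
  hom := ∑ g, Inv.conj g φ
  comm g := by
    refine Inv.comm_of_conj ?_
    have := A.additive g
    have h : Inv.conj g (∑ h, Inv.conj h φ) = ∑ h, Inv.conj g (Inv.conj h φ) := by
      simp only [Inv.conj, Functor.map_sum, Preadditive.sum_comp, Preadditive.comp_sum]
    rw [h]
    simp only [Inv.conj_conj]
    exact Equiv.sum_comp (Equiv.mulLeft g) fun h => Inv.conj h φ

lemma Inv.avg_comp (φ : P.obj ⟶ Q.obj) (f : Q ⟶ R) :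
    Inv.avg φ ≫ f = Inv.avg (Q := R) (φ ≫ f.hom) := by
  apply Inv.hom_ext
  change (∑ g, Inv.conj g φ) ≫ f.hom = ∑ g, Inv.conj (Q := R) g (φ ≫ f.hom)
  rw [Preadditive.sum_comp]
  refine Finset.sum_congr rfl fun g _ => ?_
  rw [Inv.conj_comp, Inv.conj_hom]

lemma Inv.avg_sum {J : Type*} (s : Finset J) (φ : J → (P.obj ⟶ Q.obj)) :
    ∑ j ∈ s, Inv.avg (φ j) = Inv.avg (∑ j ∈ s, φ j) := by
  apply Inv.hom_ext
  rw [Inv.sum_hom]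
  change ∑ j ∈ s, ∑ g, Inv.conj g (φ j) = ∑ g, Inv.conj g (∑ j ∈ s, φ j)
  rw [Finset.sum_comm]
  refine Finset.sum_congr rfl fun g _ => ?_
  have := A.additive g
  simp only [Inv.conj, Functor.map_sum, Preadditive.sum_comp, Preadditive.comp_sum]

lemma Inv.avg_id : Inv.avg (𝟙 P.obj) = (Fintype.card G : k) • 𝟙 P := by
  apply Inv.hom_ext
  change ∑ g, Inv.conj g (𝟙 P.obj) = (Fintype.card G : k) • 𝟙 P.obj
  have h : ∀ g : G, Inv.conj g (𝟙 P.obj) = 𝟙 P.obj := fun g => Inv.conj_hom g (𝟙 P)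
  rw [Finset.sum_congr rfl fun g _ => h g, Finset.sum_const, Finset.card_univ,
    Nat.cast_smul_eq_nsmul]

/-- If the identity of `P` is a sum of morphisms `a j ≫ b j` which factor through invariant objects
in such a way that `a j` composed with any conjugate of `b j` other than `b j` itself vanishes,
then the averages of `a` and `b` express the order of the group on `P`. -/
lemma Inv.sum_avg_comp_avg {J : Type*} [Fintype J] {Z : J → Inv A}
    (a : ∀ j, P.obj ⟶ (Z j).obj) (b : ∀ j, (Z j).obj ⟶ P.obj) (hab : ∑ j, a j ≫ b j = 𝟙 P.obj)
    (horth : ∀ j (g : G), g ≠ 1 → a j ≫ Inv.conj g (b j) = 0) :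
    ∑ j, Inv.avg (a j) ≫ Inv.avg (b j) = (Fintype.card G : k) • 𝟙 P := by
  classical
  rw [← Inv.avg_id, ← hab, ← Inv.avg_sum]
  refine Finset.sum_congr rfl fun j _ => ?_
  rw [Inv.avg_comp]
  congr 1
  change a j ≫ ∑ g, Inv.conj g (b j) = _
  rw [Preadditive.comp_sum, Finset.sum_eq_single 1, Inv.conj_one]
  · exact fun g _ hg => horth j g hg
  · exact fun h => absurd (Finset.mem_univ _) h

end Average

end Invariants

/-! ### Extension of functors to the pseudo-abelian envelope -/

section Lift

open Limits Idempotents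

variable {k : Type w} [CommRing k] {A B : Type*} [Category* A] [Preadditive A] [Linear k A]
  [Category* B] [Preadditive B] [Linear k B] [HasFiniteBiproducts B]

/-- The extension of an additive functor to formal direct sums. It is `Mat_.lift` without
restrictions on the universe levels. -/
def matLift (F : A ⥤ B) [F.Additive] : Mat_ A ⥤ B where
  obj M := ⨁ fun i => F.obj (M.X i)
  map f := biproduct.matrix fun i j => F.map (f i j)
  map_id M := by
    refine biproduct.hom_ext _ _ fun j => biproduct.hom_ext' _ _ fun i => ?_
    by_cases h : i = j
    · subst h; simp
    · simp [h]
  map_comp f g := by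
    refine biproduct.hom_ext _ _ fun j => biproduct.hom_ext' _ _ fun i => ?_
    simp [biproduct.lift_desc]

section
variable (F : A ⥤ B) [F.Additive]

/-- The inclusion of a summand of `matLift F`. -/
def matLiftι (M : Mat_ A) (i : M.ι) : F.obj (M.X i) ⟶ (matLift F).obj M :=
  biproduct.ι (fun i => F.obj (M.X i)) i

/-- The projection to a summand of `matLift F`. -/
def matLiftπ (M : Mat_ A) (i : M.ι) : (matLift F).obj M ⟶ F.obj (M.X i) :=
  biproduct.π (fun i => F.obj (M.X i)) i

variable {F} in
lemma matLift_hom_ext {M N : Mat_ A} {f g : (matLift F).obj M ⟶ (matLift F).obj N}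
    (h : ∀ i j, matLiftι F M i ≫ f ≫ matLiftπ F N j = matLiftι F M i ≫ g ≫ matLiftπ F N j) :
    f = g :=
  biproduct.hom_ext _ _ fun j => biproduct.hom_ext' _ _ fun i => h i j

lemma matLiftι_map_matLiftπ {M N : Mat_ A} (f : M ⟶ N) (i : M.ι) (j : N.ι) :
    matLiftι F M i ≫ (matLift F).map f ≫ matLiftπ F N j = F.map (f i j) := by
  change biproduct.ι (fun i => F.obj (M.X i)) i ≫ biproduct.matrix (fun i j => F.map (f i j)) ≫
    biproduct.π (fun j => F.obj (N.X j)) j = F.map (f i j)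
  rw [biproduct.matrix_π, biproduct.ι_desc]

lemma matLiftι_matLiftπ_self (M : Mat_ A) (i : M.ι) : matLiftι F M i ≫ matLiftπ F M i = 𝟙 _ :=
  biproduct.ι_π_self _ _

instance matLift_additive : (matLift F).Additive where
  map_add {M N f g} := matLift_hom_ext fun i j => by
    rw [Preadditive.add_comp, Preadditive.comp_add]
    simp only [matLiftι_map_matLiftπ]
    exact F.map_add

instance matLift_linear [F.Linear k] : (matLift F).Linear k where
  map_smul {M N} f c := matLift_hom_ext fun i j => by
    rw [Linear.smul_comp, Linear.comp_smul]
    simp only [matLiftι_map_matLiftπ]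
    exact Functor.map_smul F c _

lemma matLiftπ_matLiftι_of_forall_eq {M : Mat_ A} {i : M.ι} (hi : ∀ j, j = i) :
    matLiftπ F M i ≫ matLiftι F M i = 𝟙 _ :=
  matLift_hom_ext fun a b => by
    rw [hi a, hi b, Category.assoc, matLiftι_matLiftπ_self, Category.comp_id, Category.id_comp]

lemma matLift_map_matLiftπ_of_forall_eq {M N : Mat_ A} {i : M.ι} (hi : ∀ j, j = i) (f : M ⟶ N)
    (j : N.ι) : (matLift F).map f ≫ matLiftπ F N j = matLiftπ F M i ≫ F.map (f i j) := by
  rw [← matLiftι_map_matLiftπ, ← Category.assoc, matLiftπ_matLiftι_of_forall_eq F hi,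
    Category.id_comp]

/-- `matLift F` extends `F`. -/
def embeddingMatLiftIso : Mat_.embedding A ⋙ matLift F ≅ F :=
  NatIso.ofComponents
    (fun X =>
      { hom := matLiftπ F ((Mat_.embedding A).obj X) PUnit.unit
        inv := matLiftι F ((Mat_.embedding A).obj X) PUnit.unit
        hom_inv_id := matLiftπ_matLiftι_of_forall_eq F fun _ => rfl
        inv_hom_id := matLiftι_matLiftπ_self F ((Mat_.embedding A).obj X) PUnit.unit })
    (fun f => matLift_map_matLiftπ_of_forall_eq F (fun _ => rfl) ((Mat_.embedding A).map f)
      PUnit.unit)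

variable [IsIdempotentComplete B]

/-- The extension of an additive functor to the pseudo-abelian envelope. -/
def psLift : Ps A ⥤ B :=
  (functorExtension₂ (Mat_ A) B).obj (matLift F) ⋙ (toKaroubiEquivalence B).inverse

instance psLift_additive : (psLift F).Additive := by
  have : ((functorExtension₂ (Mat_ A) B).obj (matLift F)).Additive :=
    ⟨fun {P Q f g} => Karoubi.hom_ext _ _ (matLift F).map_add⟩
  exact inferInstanceAs (Functor.Additive (_ ⋙ _))

instance psLift_linear [F.Linear k] : (psLift F).Linear k := by
  have : ((functorExtension₂ (Mat_ A) B).obj (matLift F)).Linear k :=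
    ⟨fun {P Q} f c => Karoubi.hom_ext _ _ ((matLift F).map_smul c _)⟩
  have : (toKaroubiEquivalence B).functor.Linear k :=
    ⟨fun {P Q} f c => Karoubi.hom_ext _ _ rfl⟩
  exact inferInstanceAs (Functor.Linear k (_ ⋙ _))

/-- `psLift F` extends `matLift F`. -/
def toKaroubiPsLiftIso : toKaroubi (Mat_ A) ⋙ psLift F ≅ matLift F :=
  Functor.isoWhiskerRight
    ((functorExtension₂CompWhiskeringLeftToKaroubiIso (Mat_ A) B).app (matLift F))
    (toKaroubiEquivalence B).inverse ≪≫
  Functor.isoWhiskerLeft (matLift F) (toKaroubiEquivalence B).unitIso.symm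

/-- `psLift F` extends `F`. -/
def toPsPsLiftIso : toPs A ⋙ psLift F ≅ F :=
  Functor.isoWhiskerLeft (Mat_.embedding A) (toKaroubiPsLiftIso F) ≪≫ embeddingMatLiftIso F

/-- If every object of `B` is a direct factor of an object in the image of `matLift F` whose
idempotents lift, then `psLift F` is essentially surjective. -/
lemma psLift_essSurj (h : ∀ X : B, ∃ (M : Mat_ A) (s : X ⟶ (matLift F).obj M)
    (r : (matLift F).obj M ⟶ X), s ≫ r = 𝟙 X ∧
      ∀ e : (matLift F).obj M ⟶ (matLift F).obj M, e ≫ e = e →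
        ∃ f : M ⟶ M, f ≫ f = f ∧ (matLift F).map f = e) : (psLift F).EssSurj := by
  refine ⟨fun X => ?_⟩
  obtain ⟨M, s, r, hsr, hM⟩ := h X
  obtain ⟨f, hf, hfe⟩ := hM (r ≫ s) (by rw [Category.assoc, reassoc_of% hsr])
  let Y : Ps A := ⟨M, f, hf⟩
  let i : Y ⟶ (toKaroubi _).obj M := Y.decompId_i
  let p : (toKaroubi _).obj M ⟶ Y := Y.decompId_p
  have hip : (psLift F).map i ≫ (psLift F).map p = 𝟙 _ := by
    rw [← Functor.map_comp, ← Y.decompId, CategoryTheory.Functor.map_id]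
  have hpi : (psLift F).map p ≫ (psLift F).map i =
      (psLift F).map ((toKaroubi (Mat_ A)).map f) := by
    rw [← Functor.map_comp]
    exact congrArg (psLift F).map Y.decomp_p.symm
  let α := (toKaroubiPsLiftIso F).app M
  have hα : (psLift F).map ((toKaroubi (Mat_ A)).map f) = α.hom ≫ (r ≫ s) ≫ α.inv := by
    rw [← hfe, ← Category.assoc, Iso.eq_comp_inv]
    exact (toKaroubiPsLiftIso F).hom.naturality f
  refine ⟨Y, ⟨⟨(psLift F).map i ≫ α.hom ≫ r, s ≫ α.inv ≫ (psLift F).map p, ?_, ?_⟩⟩⟩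
  · calc ((psLift F).map i ≫ α.hom ≫ r) ≫ s ≫ α.inv ≫ (psLift F).map p =
        (psLift F).map i ≫ (α.hom ≫ (r ≫ s) ≫ α.inv) ≫ (psLift F).map p := by
          simp only [Category.assoc]
      _ = ((psLift F).map i ≫ (psLift F).map p) ≫ (psLift F).map i ≫ (psLift F).map p := by
          rw [← hα, ← hpi]; simp only [Category.assoc]
      _ = 𝟙 _ := by rw [hip, Category.comp_id]
  · calc (s ≫ α.inv ≫ (psLift F).map p) ≫ (psLift F).map i ≫ α.hom ≫ r =
        s ≫ α.inv ≫ ((psLift F).map p ≫ (psLift F).map i) ≫ α.hom ≫ r := by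
          simp only [Category.assoc]
      _ = (s ≫ r) ≫ s ≫ r := by
          rw [hpi, hα]; simp only [Category.assoc, Iso.inv_hom_id_assoc]
      _ = 𝟙 _ := by rw [hsr, Category.comp_id]

end

end Lift

/-! ### Elementary matrices -/

section MatUnit

variable {D : Type u} [Category.{v} D] [Preadditive D] {M N K : Mat_ D}

open scoped Classical in
/-- The matrix whose only nonzero entry is an identity, at the place `(i₀, j₀)`. -/
def matUnit (i₀ : M.ι) (j₀ : N.ι) (h : M.X i₀ = N.X j₀) : M ⟶ N :=
  fun i j => if hij : i₀ = i ∧ j₀ = j then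
    eqToHom (hij.1 ▸ hij.2 ▸ h) else 0

lemma matUnit_self (i₀ : M.ι) (j₀ : N.ι) (h : M.X i₀ = N.X j₀) :
    matUnit i₀ j₀ h i₀ j₀ = eqToHom h := by
  simp [matUnit]

lemma matUnit_ne_left {i₀ i : M.ι} {j₀ : N.ι} (h : M.X i₀ = N.X j₀) (hi : i ≠ i₀) (j : N.ι) :
    matUnit i₀ j₀ h i j = 0 :=
  dif_neg fun h' => hi h'.1.symm

lemma matUnit_ne_right {i₀ : M.ι} {j₀ j : N.ι} (h : M.X i₀ = N.X j₀) (hj : j ≠ j₀) (i : M.ι) :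
    matUnit i₀ j₀ h i j = 0 :=
  dif_neg fun h' => hj h'.2.symm

lemma matUnit_comp_self (i₀ : M.ι) (j₀ : N.ι) (h : M.X i₀ = N.X j₀) (F : N ⟶ K) (l : K.ι) :
    (matUnit i₀ j₀ h ≫ F) i₀ l = eqToHom h ≫ F j₀ l := by
  rw [Mat_.comp_apply, Finset.sum_eq_single j₀, matUnit_self]
  · intro j _ hj
    rw [matUnit_ne_right h hj, Limits.zero_comp]
  · intro hi; exact absurd (Finset.mem_univ _) hi

lemma matUnit_comp_ne {i₀ i : M.ι} {j₀ : N.ι} (h : M.X i₀ = N.X j₀) (hi : i ≠ i₀) (F : N ⟶ K)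
    (l : K.ι) : (matUnit i₀ j₀ h ≫ F) i l = 0 := by
  rw [Mat_.comp_apply]
  exact Finset.sum_eq_zero fun j _ => by rw [matUnit_ne_left h hi, Limits.zero_comp]

/-- Evaluation of matrices at a place, as an additive map. -/
def matEntry (i : M.ι) (j : N.ι) : (M ⟶ N) →+ (M.X i ⟶ N.X j) where
  toFun f := f i j
  map_zero' := rfl
  map_add' _ _ := rfl

/-- The decomposition of the identity into elementary matrices, routed through other direct
sums. -/
lemma sum_matUnit_comp_matUnit (N : M.ι → Mat_ D) (j₀ : ∀ i, (N i).ι)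
    (h : ∀ i, M.X i = (N i).X (j₀ i)) :
    ∑ i, matUnit i (j₀ i) (h i) ≫ matUnit (j₀ i) i (h i).symm = 𝟙 M := by
  apply Mat_.hom_ext
  intro i l
  refine (map_sum (matEntry i l) _ _).trans ?_
  change ∑ j, (matUnit j (j₀ j) (h j) ≫ matUnit (j₀ j) j (h j).symm) i l = _
  rw [Finset.sum_eq_single i, matUnit_comp_self]
  · by_cases hil : i = l
    · subst hil
      rw [matUnit_self, Mat_.id_apply_self, eqToHom_trans, eqToHom_refl]
    · rw [matUnit_ne_right _ (Ne.symm hil), Mat_.id_apply_of_ne _ _ _ hil, Limits.comp_zero]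
  · intro j _ hj
    exact matUnit_comp_ne _ hj.symm _ _
  · intro hi; exact absurd (Finset.mem_univ _) hi

end MatUnit

/-! ### The functor to the wreath product category -/

section Functor

open Limits Idempotents

variable {k : Type w} [CommRing k] {C : Type u} [Category.{v} C] [Preadditive C] [Linear k C]

instance {d : ℕ} : HasFiniteBiproducts (WCat k C d) := Inv.hasFiniteBiproducts

instance {d : ℕ} : IsIdempotentComplete (WCat k C d) := Inv.isIdempotentComplete

variable (o : UnitObj k C) (d : ℕ)

/-- The functor `⟨U_I⟩ ↦ [U_I]`, `⟨Φ⟩ ↦ [Φ]`, before passing to the pseudo-abelian envelope. -/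
def brFunctor : SPre o d ⥤ WCat k C d where
  obj U := brObj o d U.fam
  map Φ := brHom o Φ
  map_id U := by
    apply Inv.hom_ext
    apply Karoubi.hom_ext
    exact brMat_id o U.fam
  map_comp Φ Ψ := by
    apply Inv.hom_ext
    apply Karoubi.hom_ext
    exact brMat_comp o Φ Ψ

instance : (brFunctor o d).Additive where
  map_add {U V Φ Ψ} := map_add (brHom o (d := d) (U := U.fam) (V := V.fam)) Φ Ψ

instance : (brFunctor o d).Linear k where
  map_smul {U V} Φ c := map_smul (brHom o (d := d) (U := U.fam) (V := V.fam)) c Φ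

lemma agToBr_eq_zero_iff {U V : Fam C} (f : agObj o d U ⟶ agObj o d V) :
    agToBr o d U V f = 0 ↔ (ag o d).symm f ∈ HHgt o U V d :=
  brHom_eq_zero_iff o _

lemma agToBr_surjective (U V : Fam C) : Function.Surjective (agToBr o d U V) := by
  intro F
  obtain ⟨Φ, -, hΦ⟩ := exists_brHom_eq o F
  exact ⟨ag o d Φ, by simpa [agToBr] using hΦ⟩

lemma ker_agToBr (U V : Fam C) :
    LinearMap.ker (agToBr o d U V) = (HHgt o U V d).map (ag o d).toLinearMap := by
  ext f
  rw [LinearMap.mem_ker, agToBr_eq_zero_iff, Submodule.mem_map]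
  constructor
  · exact fun h => ⟨_, h, (ag o d).apply_symm_apply f⟩
  · rintro ⟨Φ, h, rfl⟩
    simpa using h

/-- For families of `d` objects, `⟨Φ⟩ ↦ [Φ]` has a multiplicative section, given by the recollements
with `d` classes. Hence idempotents lift. -/
lemma exists_idempotent_lift (M : Mat_ (SPre o d)) (hM : ∀ i, Fintype.card (M.X i).fam.ι = d)
    (e : (matLift (brFunctor o d)).obj M ⟶ (matLift (brFunctor o d)).obj M) (he : e ≫ e = e) :
    ∃ f : M ⟶ M, f ≫ f = f ∧ (matLift (brFunctor o d)).map f = e := by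
  choose f hf hfe using fun i j : M.ι => exists_brHom_eq o
    (matLiftι (brFunctor o d) M i ≫ e ≫ matLiftπ (brFunctor o d) M j)
  let f' : M ⟶ M := f
  have hfe' : (matLift (brFunctor o d)).map f' = e := by
    refine matLift_hom_ext fun i j => ?_
    exact (matLiftι_map_matLiftπ (brFunctor o d) f' i j).trans (hfe i j)
  refine ⟨f', ?_, hfe'⟩
  apply Mat_.hom_ext
  intro i j
  -- `f' ≫ f' - f'` lies in the kernel and in its complement.
  have h1 : (f' ≫ f') i j ∈ HHle o (M.X i).fam (M.X j).fam d := by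
    rw [Mat_.comp_apply]
    exact Submodule.sum_mem _ fun l _ => compH_mem_HHle o (d : k) (hM l) (hf i l) (hf l j)
  have h2 : (brFunctor o d).map ((f' ≫ f') i j) = (brFunctor o d).map (f' i j) := by
    rw [← matLiftι_map_matLiftπ, ← matLiftι_map_matLiftπ, Functor.map_comp, hfe', he]
  have h3 : brHom o (d := d) ((f' ≫ f') i j - f' i j) = 0 := by
    rw [map_sub]
    exact sub_eq_zero.2 h2
  exact sub_eq_zero.1 (HHle_inf_HHgt o (Submodule.sub_mem _ h1 (hf i j))
    ((brHom_eq_zero_iff o _).1 h3))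

variable {d} in
/-- The factors of an object of the tensor power, as a family. -/
def TP.fam (X : TP k C d) : Fam C where
  ι := Fin d
  X := X.obj

/-- The sequence in which the elements occur in their order. -/
def idSeq (d : ℕ) : Seq d (Fin d) := ⟨some, isSeq_some⟩

variable {d} in
lemma permSeq_symm_idSeq_ne {g : Equiv.Perm (Fin d)} (hg : g ≠ 1) :
    (permSeq g).symm (idSeq d) ≠ idSeq d := by
  intro h
  refine hg (Equiv.ext fun a => ?_)
  exact Option.some_injective _ (congrFun (congrArg Subtype.val h) a)

/-- `U₁ ⊠ ⋯ ⊠ U_d` is a direct summand of `[U]` whose conjugates are pairwise orthogonal. -/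
lemma matUnit_comp_brPermInv_comp (M : Mat_ (TP k C d)) (j : M.ι) {g : Equiv.Perm (Fin d)}
    (hg : g ≠ 1) :
    matUnit (M := M) (N := brMatObj o d (M.X j).fam) j (idSeq d) rfl ≫
      brPermInv o (M.X j).fam g ≫ (permTP k C g).mapMat_.map
        (matUnit (M := brMatObj o d (M.X j).fam) (N := M) (idSeq d) j rfl) = 0 := by
  apply Mat_.hom_ext
  intro i l
  by_cases hij : i = j
  · subst hij
    have h1 : (brPermInv o (M.X i).fam g ≫ (permTP k C g).mapMat_.map
        (matUnit (M := brMatObj o d (M.X i).fam) (N := M) (idSeq d) i rfl)) (idSeq d) l = 0 := by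
      refine (matPerm_comp_apply (M := brMatObj o d (M.X i).fam)
        (N := (permTP k C g).mapMat_.obj (brMatObj o d (M.X i).fam)) _ _ _ _ _).trans ?_
      have h2 := matUnit_ne_left (M := brMatObj o d (M.X i).fam) (N := M) (i₀ := idSeq d)
        (j₀ := i) rfl (permSeq_symm_idSeq_ne hg) l
      refine (congrArg (_ ≫ ·) ((congrArg (permTP k C g).map h2).trans
        (Functor.map_zero _ _ _))).trans ?_
      exact comp_zero
    refine (matUnit_comp_self (M := M) (N := brMatObj o d (M.X i).fam) i (idSeq d) rfl _ l).trans ?_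
    exact (congrArg (_ ≫ ·) h1).trans comp_zero
  · exact matUnit_comp_ne _ hij _ _

/-- A decomposition of the identity of `P.X` induces one of the identity of its direct factor
`P`. -/
lemma sum_decompId_comp {E : Type*} [Category* E] [Preadditive E] (P : Karoubi E) {J : Type*}
    [Fintype J] {N : J → E} (A : ∀ j, P.X ⟶ N j) (B : ∀ j, N j ⟶ P.X)
    (h : ∑ j, A j ≫ B j = 𝟙 P.X) :
    ∑ j, (P.decompId_i ≫ (toKaroubi E).map (A j)) ≫ ((toKaroubi E).map (B j) ≫ P.decompId_p) =
      𝟙 P := by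
  apply Karoubi.hom_ext
  rw [Karoubi.sum_hom]
  have h1 : ∀ j, (P.p ≫ A j) ≫ B j ≫ P.p = P.p ≫ (A j ≫ B j) ≫ P.p := fun j => by
    simp only [Category.assoc]
  refine (Finset.sum_congr rfl fun j _ => h1 j).trans ?_
  rw [← Preadditive.comp_sum, ← Preadditive.sum_comp, h, Category.id_comp, P.idem]
  rfl

/-- If `d!` is invertible, every object of the wreath product category is a direct factor of a sum
of objects `[U]` for families `U` of `d` objects. -/
lemma exists_retract (hd : IsUnit ((d.factorial : ℕ) : k)) (X : WCat k C d) :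
    ∃ (M : Mat_ (SPre o d)) (s : X ⟶ (matLift (brFunctor o d)).obj M)
      (r : (matLift (brFunctor o d)).obj M ⟶ X), s ≫ r = 𝟙 X ∧
        ∀ i, Fintype.card (M.X i).fam.ι = d := by
  -- `X` is a direct factor of a formal sum `P.X` of objects `U₁ ⊠ ⋯ ⊠ U_d`, and each of these is
  -- the summand of `[U]` at the sequence `(1, …, d)`; `a` and `b` are the resulting maps.
  let P : Ps (TP k C d) := X.obj
  let Z : P.X.ι → WCat k C d := fun j => brObj o d (P.X.X j).fam
  let A : ∀ j, P.X ⟶ brMatObj o d (P.X.X j).fam := fun j =>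
    matUnit (N := brMatObj o d (P.X.X j).fam) j (idSeq d) rfl
  let B : ∀ j, brMatObj o d (P.X.X j).fam ⟶ P.X := fun j =>
    matUnit (M := brMatObj o d (P.X.X j).fam) (idSeq d) j rfl
  have hAB : ∑ j, A j ≫ B j = 𝟙 P.X :=
    sum_matUnit_comp_matUnit (M := P.X) (fun j => brMatObj o d (P.X.X j).fam)
      (fun _ => idSeq d) fun _ => rfl
  let a : ∀ j, X.obj ⟶ (Z j).obj := fun j => P.decompId_i ≫ (toKaroubi _).map (A j)
  let b : ∀ j, (Z j).obj ⟶ X.obj := fun j => (toKaroubi _).map (B j) ≫ P.decompId_p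
  have hab : ∑ j, a j ≫ b j = 𝟙 X.obj := sum_decompId_comp P A B hAB
  have horth : ∀ j (g : Equiv.Perm (Fin d)), g ≠ 1 → a j ≫ Inv.conj g (b j) = 0 := by
    intro j g hg
    have h1 : (toKaroubi _).map (A j) ≫ ((Z j).κ g).inv ≫
        ((permAction k C d).act g).map ((toKaroubi _).map (B j)) = 0 := by
      apply Karoubi.hom_ext
      exact matUnit_comp_brPermInv_comp o d P.X j hg
    exact Inv.comp_conj_eq_zero _ _ h1
  have hsum := Inv.sum_avg_comp_avg (P := X) (Z := Z) a b hab horth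
  obtain ⟨c, hc⟩ := hd.exists_left_inv
  refine ⟨⟨P.X.ι, fun j => ⟨(P.X.X j).fam⟩⟩, c • biproduct.lift fun j => Inv.avg (a j),
    biproduct.desc fun j => Inv.avg (b j), ?_, fun i => Fintype.card_fin d⟩
  refine (Linear.smul_comp _ _ _ _ _ _).trans ?_
  refine (congrArg (c • ·) (biproduct.lift_desc.trans hsum)).trans ?_
  rw [smul_smul, Fintype.card_perm, Fintype.card_fin, hc, one_smul]

end Functor

end Wreath

end

theorem mainTheorem4 {k : Type w} [CommRing k] {C : Type u} [Category.{v} C]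
    [Preadditive C] [Linear k C] (o : Wreath.UnitObj k C) (d : ℕ) :
    (∀ U V : Wreath.Fam C,
      Function.Surjective (Wreath.agToBr o d U V) ∧
      LinearMap.ker (Wreath.agToBr o d U V) =
        (Wreath.HHgt o U V d).map (Wreath.ag o d).toLinearMap ∧
      (Fintype.card U.ι + Fintype.card V.ι ≤ d →
        Function.Bijective (Wreath.agToBr o d U V))) ∧
    ∃ F : Wreath.SCat o d ⥤ Wreath.WCat k C d,
      F.Additive ∧ F.Linear k ∧
      (∃ η : ∀ U : Wreath.Fam C, F.obj (Wreath.agObj o d U) ≅ Wreath.brObj o d U,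
        ∀ (U V : Wreath.Fam C) (f : Wreath.agObj o d U ⟶ Wreath.agObj o d V),
          F.map f ≫ (η V).hom = (η U).hom ≫ Wreath.agToBr o d U V f) ∧
      (IsUnit ((d.factorial : ℕ) : k) → F.EssSurj) := by
  refine ⟨fun U V => ⟨Wreath.agToBr_surjective o d U V, Wreath.ker_agToBr o d U V, fun h =>
    ⟨LinearMap.ker_eq_bot.1 ?_, Wreath.agToBr_surjective o d U V⟩⟩,
    Wreath.psLift (Wreath.brFunctor o d), inferInstance, inferInstance,
    ⟨fun U => (Wreath.toPsPsLiftIso (Wreath.brFunctor o d)).app ⟨U⟩, fun U V f => ?_⟩, fun hd => ?_⟩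
  · rw [Wreath.ker_agToBr, Wreath.HHgt_eq_bot o h, Submodule.map_bot]
  · obtain ⟨Φ, rfl⟩ := (Wreath.ag o d).surjective f
    exact (Wreath.toPsPsLiftIso (Wreath.brFunctor o d)).hom.naturality (X := ⟨U⟩) (Y := ⟨V⟩) Φ
  · refine Wreath.psLift_essSurj _ fun X => ?_
    obtain ⟨M, s, r, hsr, hM⟩ := Wreath.exists_retract o d hd X
    exact ⟨M, s, r, hsr, Wreath.exists_idempotent_lift o d M hM⟩
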